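/- **Setting.** Let $I=(-1,1)$, $V=H^1_0(I)$ with inner product $(v,w)=\int_I Dv\,Dw$ and norm $\|v\|=(\int_I|Dv|^2)^{1/2}$; $H^{-1}(I)$ carries the dual norm, also written $\|\cdot\|$. Let $\mathbb N_2=\{k\in\mathbb N: k\ge 2\}$, let $L_k$ be the Legendre polynomials and $\eta_k(x)=\sqrt{k-1/2}\int_x^1L_{k-1}(s)\,ds$ ($k\in\mathbb N_2$) the Babuška–Shen basis of $V$, which is orthonormal; put $\hat v_k=\int_I Dv\,D\eta_k$ for $v\in V$ and $\hat f_k=\langle f,\eta_k\rangle$, $\langle\eta_k^*,v\rangle=\hat v_k$ for $f\in H^{-1}(I)$. For finite $\Lambda\subset\mathbb N_2$ let $V_\Lambda=\mathrm{span}\{\eta_k:k\in\Lambda\}$, $P_\Lambda v=\sum_{k\in\Lambda}\hat v_k\eta_k$, $P_\Lambda f=\sum_{k\in\Lambda}\hat f_k\eta_k^*$. For $g$ in $V$ or in $H^{-1}(I)$ let $E_N(g)=\inf_{|\Lambda|=N}\|g-P_\Lambda g\|$, and for $\eta>0$, $t\in(0,1]$ let $\mathcal A^{\eta,t}_G$ be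 the set of $g$ with $\|g\|_{\mathcal A^{\eta,t}_G}:=\sup_{N\ge0}E_N(g)e^{\eta N^t}<\infty$. Let $\nu,\sigma$ be measurable with $0<\nu_*\le\nu\le\nu^*<\infty$ and $0\le\sigma\le\sigma^*<\infty$ on $I$, $\alpha_*=\nu_*$, $\alpha^*=\max(\nu^*,\sigma^*)$, $a(v,w)=\int_I\nu\,Dv\,Dw+\int_I\sigma vw$, $\langle Lv,w\rangle=a(v,w)$. Given $f\in H^{-1}(I)$, let $u\in V$ solve $a(u,v)=\langle f,v\rangle$ for all $v\in V$; $u_\Lambda\in V_\Lambda$ is the Galerkin solution in $V_\Lambda$, and $r(w)=f-Lw$. Let $\mathbf A=(a(\eta_n,\eta_m))_{m,n\ge2}$, with inverse matrix $\mathbf A^{-1}$ on $\ell^2(\mathbb N_2)$. Write $\mathbf M\in\mathcal D_e(\gamma)$ if $|M_{m,n}|\le c\,e^{-\gamma|m-n|}$ for some $c>0$ and all $m,n$; $\mathbf M_J$ is $\mathbf M$ with the entries with $|m-n|>J$ replaced by $0$. Let $\bar\eta_L>0$ and $C_{\mathbf A^{-1}}$ be constants with $\|\mathbf A^{-1}-(\mathbf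 A^{-1})_J\|\le C_{\mathbf A^{-1}}e^{-\bar\eta_LJ}$ for all integers $J\ge0$, and for $\theta\in(0,1)$ let $J_\theta$ be the least integer $J\geq 1$ with $C_{\mathbf A^{-1}}e^{-\bar\eta_LJ}\le\sqrt{(1-\theta^2)/(\alpha_*\alpha^*)}$. **Algorithm PC-ADLEG**$(\theta,tol)$, $\theta\in(0,1)$, $tol\in[0,1)$. Start from $\Lambda_0=\emptyset$, $u_0=0$, $r_0=f$. For $n=0,1,\dots$: choose a finite set $\widetilde{\partial\Lambda}_n\subset\mathbb N_2$ of minimal cardinality with $\|P_{\widetilde{\partial\Lambda}_n}r_n\|\ge\theta\|r_n\|$; let $\widehat\Lambda_{n+1}=\Lambda_n\cup\{k\in\mathbb N_2:\ |k-\ell|\le J_\theta\text{ for some }\ell\in\widetilde{\partial\Lambda}_n\}$ and let $\hat u_{n+1}$ be the Galerkin solution in $V_{\widehat\Lambda_{n+1}}$; choose $\Lambda_{n+1}\subseteq\widehat\Lambda_{n+1}$ of minimal cardinality with $\|\hat u_{n+1}-P_{\Lambda_{n+1}}\hat u_{n+1}\|\le2\epsilon_n$, $\epsilon_n=\frac2{\alpha_*}\sqrt{1-\theta^2}\,\|r_n\|$;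 let $u_{n+1}$ be the Galerkin solution in $V_{\Lambda_{n+1}}$ and $r_{n+1}=r(u_{n+1})$; continue as long as $\|r_{n+1}\|>tol$. **Theorem (cardinality of PC-ADLEG).** Let $\eta>0$ and $t\in(0,1]$. (i) There is a constant $C>1$, independent of $f$, $u$, $\theta$, $tol$, $n$ and of the choices made by the algorithm, such that, if $u\in\mathcal A^{\eta,t}_G$, then for every $n\ge0$ reached by the algorithm with $u_n\ne u$ (for $u_n=u$ the right-hand side is $+\infty$) the quantity in parentheses below is nonnegative and $$|\Lambda_n|\le\frac1{\eta^{1/t}}\Big(\log\frac{\|u\|_{\mathcal A^{\eta,t}_G}}{\|u-u_n\|}+\log C\Big)^{1/t}+1 .$$ (ii) This bound is optimal relative to the class: for all $0<\varepsilon<K$ there is $v\in\mathcal A^{\eta,t}_G$ with $\|v\|_{\mathcal A^{\eta,t}_G}=K$ such that every finite $\Lambda\subset\mathbb N_2$ with $\|v-P_\Lambda v\|\le\varepsilon$ satisfies $|\Lambda|\ge\eta^{-1/t}(\log(K/\varepsilon))^{1/t}$. (iii) Suppose in addition that $\mathbf A\in\mathcal D_e(\eta_L)$ and $\mathbf A^{-1}\in\mathcal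 D_e(\bar\eta_L)$ with $\bar\eta_L\in(0,\eta_L]$, and that $\eta<\bar\eta_L$. Then there are $0<\bar\eta\le\eta$ and $0<\bar t\le t$, independent of $f$, $u$, $\theta$, $tol$, and constants $K$ and $C>1$, independent of $f$, $u$, $\theta$, $tol$, $n$ and of the choices made by the algorithm, such that, whenever $u\in\mathcal A^{\eta,t}_G$: for every finite $\Lambda\subset\mathbb N_2$ one has $r(u_\Lambda)\in\mathcal A^{\bar\eta,\bar t}_G$ with $\|r(u_\Lambda)\|_{\mathcal A^{\bar\eta,\bar t}_G}\le K\|u\|_{\mathcal A^{\eta,t}_G}$; and for every performed iteration $n\ge0$ with $u_{n+1}\ne u$ the quantity in parentheses below is nonnegative and $$|\widehat\Lambda_{n+1}|\le|\Lambda_n|+\frac{2J_\theta}{\bar\eta^{1/\bar t}}\Big(\log\frac{\|u\|_{\mathcal A^{\eta,t}_G}}{\|u-u_{n+1}\|}+\log C\Big)^{1/\bar t}+2J_\theta .$$ -/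

import Mathlib

open MeasureTheory Set Polynomial

noncomputable section

namespace PCADLEG

/-! ### Lebesgue measure on the interval and the space `H¹₀(-1,1)` -/

/-- Lebesgue measure on the open interval `I = (-1,1)`. -/
abbrev muI : Measure ℝ := volume.restrict (Ioo (-1 : ℝ) 1)

/-- The functions of class `H¹₀(-1,1)`: absolutely continuous on `[-1,1]`, with square integrable
derivative, and vanishing at the end points. They are extended by zero outside `(-1,1)`, so that
a function is determined by its values on the interval. -/
def h10Submodule : Submodule ℝ (ℝ → ℝ) where
  carrier := {v | AbsolutelyContinuousOnInterval v (-1) 1 ∧ MemLp (deriv v) 2 muI ∧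
    ∀ x, x ∉ Ioo (-1 : ℝ) 1 → v x = 0}
  zero_mem' := by
    refine ⟨?_, ?_, fun x _ => rfl⟩
    · exact ContDiffOn.absolutelyContinuousOnInterval (contDiff_const (c := (0 : ℝ))).contDiffOn
    · have : deriv (0 : ℝ → ℝ) = fun _ => 0 := by
        funext x
        exact deriv_const x (0 : ℝ)
      rw [this]
      exact MemLp.zero'
  add_mem' := by
    rintro v w ⟨hv, hv', hv0⟩ ⟨hw, hw', hw0⟩
    refine ⟨hv.add hw, ?_, fun x hx => by simp [hv0 x hx, hw0 x hx]⟩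
    refine (hv'.add hw').ae_eq ?_
    rw [Filter.EventuallyEq, ae_restrict_iff' measurableSet_Ioo]
    filter_upwards [hv.ae_differentiableAt, hw.ae_differentiableAt] with x h1 h2 hx
    have hx' : x ∈ uIcc (-1 : ℝ) 1 := by
      rw [uIcc_of_le (by norm_num)]
      exact Ioo_subset_Icc_self hx
    exact (deriv_add (h1 hx') (h2 hx')).symm
  smul_mem' := by
    rintro c v ⟨hv, hv', hv0⟩
    refine ⟨hv.const_mul c, ?_, fun x hx => by simp [hv0 x hx]⟩
    refine (hv'.const_smul c).ae_eq ?_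
    refine Filter.Eventually.of_forall fun x => ?_
    exact (deriv_const_smul_field c v).symm

/-- The space `V = H¹₀(-1,1)`. -/
def H10 : Type := h10Submodule

namespace H10

instance : AddCommGroup H10 := inferInstanceAs (AddCommGroup h10Submodule)

instance : Module ℝ H10 := inferInstanceAs (Module ℝ h10Submodule)

instance : CoeFun H10 (fun _ => ℝ → ℝ) := ⟨fun v => v.1⟩

/-- The derivative `Dv`, defined almost everywhere on the interval. -/
def D (v : H10) : ℝ → ℝ := deriv v.1

theorem memLp_D (v : H10) : MemLp v.D 2 muI := v.2.2.1

theorem ae_D_add (v w : H10) : (v + w).D =ᵐ[muI] v.D + w.D := by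
  rw [Filter.EventuallyEq, ae_restrict_iff' measurableSet_Ioo]
  filter_upwards [v.2.1.ae_differentiableAt, w.2.1.ae_differentiableAt] with x h1 h2 hx
  have hx' : x ∈ uIcc (-1 : ℝ) 1 := by
    rw [uIcc_of_le (by norm_num)]
    exact Ioo_subset_Icc_self hx
  exact deriv_add (h1 hx') (h2 hx')

theorem D_smul (c : ℝ) (v : H10) : (c • v).D = c • v.D := by
  funext x
  exact deriv_const_smul_field c v.1

theorem integrable_D_mul_D (v w : H10) : Integrable (fun x => v.D x * w.D x) muI :=
  v.memLp_D.integrable_mul w.memLp_D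

theorem eq_integral_D (v : H10) {x : ℝ} (hx : x ∈ Icc (-1 : ℝ) 1) :
    v x = ∫ s in (-1 : ℝ)..x, v.D s := by
  have h : AbsolutelyContinuousOnInterval v.1 (-1) x := by
    refine v.2.1.mono ?_
    rw [uIcc_of_le hx.1, uIcc_of_le (by norm_num)]
    exact Icc_subset_Icc le_rfl hx.2
  have h0 : v.1 (-1) = 0 := v.2.2.2 (-1) (by simp)
  have := h.integral_deriv_eq_sub
  rw [h0, sub_zero] at this
  exact this.symm

/-- The inner product `(v,w)_{H¹₀} = ∫ Dv Dw`. -/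
instance core : InnerProductSpace.Core ℝ H10 where
  inner v w := ∫ x, v.D x * w.D x ∂muI
  conj_inner_symm v w := by
    simp only [conj_trivial]
    congr 1
    funext x
    ring
  re_inner_nonneg v := integral_nonneg fun x => mul_self_nonneg _
  add_left v w z := by
    rw [← integral_add (integrable_D_mul_D v z) (integrable_D_mul_D w z)]
    refine integral_congr_ae ?_
    filter_upwards [ae_D_add v w] with x hx
    rw [hx, Pi.add_apply]
    ring
  smul_left v w r := by
    simp only [conj_trivial]
    rw [← integral_const_mul]
    congr 1
    funext x
    rw [D_smul, Pi.smul_apply, smul_eq_mul]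
    ring
  definite v hv := by
    have h1 : (fun x => v.D x * v.D x) =ᵐ[muI] 0 :=
      (integral_eq_zero_iff_of_nonneg (fun x => mul_self_nonneg _)
        (integrable_D_mul_D v v)).1 hv
    have h2 : ∀ᵐ x, x ∈ Ioo (-1 : ℝ) 1 → v.D x = 0 := by
      rw [Filter.EventuallyEq, ae_restrict_iff' measurableSet_Ioo] at h1
      filter_upwards [h1] with x hx hxI
      exact mul_self_eq_zero.1 (hx hxI)
    refine Subtype.ext (funext fun x => ?_)
    by_cases hx : x ∈ Ioo (-1 : ℝ) 1
    · change v x = 0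
      rw [eq_integral_D v (Ioo_subset_Icc_self hx)]
      refine intervalIntegral.integral_zero_ae ?_
      filter_upwards [h2] with s hs hsx
      rw [uIoc_of_le hx.1.le] at hsx
      exact hs ⟨hsx.1, hsx.2.trans_lt hx.2⟩
    · exact v.2.2.2 x hx

/-- The norm of `H10` is the `H¹₀`-norm `‖v‖ = (∫ |Dv|²)^{1/2}`. -/
instance : NormedAddCommGroup H10 := InnerProductSpace.Core.toNormedAddCommGroup (𝕜 := ℝ)

instance : InnerProductSpace ℝ H10 := InnerProductSpace.ofCore core.toCore

theorem inner_def (v w : H10) : inner ℝ v w = ∫ x, v.D x * w.D x ∂muI := rfl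

theorem norm_sq (v : H10) : ‖v‖ ^ 2 = ∫ x, v.D x * v.D x ∂muI := by
  rw [← real_inner_self_eq_norm_sq, inner_def]

theorem norm_eq (v : H10) : ‖v‖ = (∫ x, ‖v.D x‖ ^ (2 : ℝ) ∂muI) ^ (1 / 2 : ℝ) := by
  have h : (∫ x, ‖v.D x‖ ^ (2 : ℝ) ∂muI) = ‖v‖ ^ 2 := by
    rw [norm_sq]
    congr 1
    funext x
    rw [Real.rpow_two, Real.norm_eq_abs, sq_abs, sq]
  rw [h, ← Real.sqrt_eq_rpow, Real.sqrt_sq (norm_nonneg v)]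

theorem integral_norm_D_mul_le (v w : H10) :
    ∫ x, ‖v.D x‖ * ‖w.D x‖ ∂muI ≤ ‖v‖ * ‖w‖ := by
  have := integral_mul_norm_le_Lp_mul_Lq (μ := muI) (f := v.D) (g := w.D)
    Real.HolderConjugate.two_two (by simpa using v.memLp_D) (by simpa using w.memLp_D)
  rwa [← norm_eq, ← norm_eq] at this

theorem abs_apply_le (v : H10) (x : ℝ) : |v x| ≤ 2 * ‖v‖ := by
  by_cases hx : x ∈ Ioo (-1 : ℝ) 1
  · have h1 : MemLp (fun _ : ℝ => (1 : ℝ)) 2 muI := memLp_const 1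
    have h2 := integral_mul_norm_le_Lp_mul_Lq (μ := muI) (f := v.D) (g := fun _ => (1 : ℝ))
      Real.HolderConjugate.two_two (by simpa using v.memLp_D) (by simpa using h1)
    rw [← norm_eq] at h2
    have h3 : (∫ _ : ℝ, ‖(1 : ℝ)‖ ^ (2 : ℝ) ∂muI) ^ (1 / 2 : ℝ) ≤ 2 := by
      have : (∫ _ : ℝ, ‖(1 : ℝ)‖ ^ (2 : ℝ) ∂muI) = 2 := by
        simp [Measure.real]
        norm_num
      rw [this]
      exact Real.rpow_le_self_of_one_le (by norm_num) (by norm_num)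
    have hint : Integrable v.D muI := v.memLp_D.integrable (by norm_num)
    rw [eq_integral_D v (Ioo_subset_Icc_self hx), intervalIntegral.integral_of_le hx.1.le]
    calc |∫ s in Ioc (-1 : ℝ) x, v.D s| ≤ ∫ s in Ioc (-1 : ℝ) x, ‖v.D s‖ := by
          rw [← Real.norm_eq_abs]
          exact norm_integral_le_integral_norm _
      _ ≤ ∫ s, ‖v.D s‖ ∂muI := by
          refine setIntegral_mono_set hint.norm (Filter.Eventually.of_forall fun s => norm_nonneg _) ?_
          exact Filter.Eventually.of_forall fun s hs => ⟨hs.1, lt_of_le_of_lt hs.2 hx.2⟩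
      _ = ∫ s, ‖v.D s‖ * ‖(1 : ℝ)‖ ∂muI := by simp
      _ ≤ _ := h2
      _ ≤ 2 * ‖v‖ := by
          rw [mul_comm]
          exact mul_le_mul_of_nonneg_right h3 (norm_nonneg v)
  · have : v x = 0 := v.2.2.2 x hx
    rw [this, abs_zero]
    positivity

theorem continuousOn (v : H10) : ContinuousOn v.1 (Ioo (-1 : ℝ) 1) := by
  refine v.2.1.continuousOn.mono ?_
  rw [uIcc_of_le (by norm_num)]
  exact Ioo_subset_Icc_self

end H10

/-- `H⁻¹(-1,1)`, the dual of `H¹₀(-1,1)`; its norm is the dual norm. -/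
abbrev Hm1 : Type := StrongDual ℝ H10

/-! ### The Legendre and the Babuška–Shen basis -/

/-- The Legendre polynomial `L_n` (Rodrigues' formula). -/
def legendre (n : ℕ) : ℝ[X] :=
  C (1 / (2 ^ n * (n.factorial : ℝ))) * derivative^[n] ((X ^ 2 - 1) ^ n)

/-- The index set `{k ∈ ℕ : k ≥ 2}`. -/
abbrev N2 : Type := {k : ℕ // 2 ≤ k}

/-- The function `η_k(x) = √(k - 1/2) ∫_x^1 L_{k-1}(s) ds` on `(-1,1)`, extended by zero. -/
def etaFun (k : N2) (x : ℝ) : ℝ :=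
  if x ∈ Ioo (-1 : ℝ) 1 then
    Real.sqrt ((k.1 : ℝ) - 1 / 2) * ∫ s in x..1, (legendre (k.1 - 1)).eval s
  else 0

theorem isRoot_iterate_derivative (n : ℕ) {a : ℝ} (ha : a ^ 2 = 1) :
    (derivative^[n] ((X ^ 2 - 1 : ℝ[X]) ^ (n + 1))).IsRoot a := by
  refine isRoot_iterate_derivative_of_lt_rootMultiplicity ?_
  have hne : ((X ^ 2 - 1 : ℝ[X]) ^ (n + 1)) ≠ 0 := by
    refine pow_ne_zero _ ?_
    have := X_pow_sub_C_ne_zero (R := ℝ) (n := 2) (by norm_num) 1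
    simpa using this
  refine Nat.lt_of_succ_le ((le_rootMultiplicity_iff hne).2 (pow_dvd_pow_of_dvd ?_ (n + 1)))
  rw [dvd_iff_isRoot]
  simp [ha]

/-- A polynomial primitive of `-√(k - 1/2) L_{k-1}` vanishing at both end points. -/
def etaPoly (k : N2) : ℝ[X] :=
  C (-(Real.sqrt ((k.1 : ℝ) - 1 / 2) * (1 / (2 ^ (k.1 - 1) * ((k.1 - 1).factorial : ℝ))))) *
    derivative^[k.1 - 2] ((X ^ 2 - 1) ^ (k.1 - 1))

theorem etaPoly_eval_eq_zero (k : N2) {a : ℝ} (ha : a ^ 2 = 1) : (etaPoly k).eval a = 0 := by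
  have h := isRoot_iterate_derivative (k.1 - 2) ha
  have hk : k.1 - 2 + 1 = k.1 - 1 := by have := k.2; omega
  rw [hk] at h
  rw [etaPoly, eval_mul, h.eq_zero, mul_zero]

theorem derivative_etaPoly (k : N2) :
    derivative (etaPoly k) = C (-Real.sqrt ((k.1 : ℝ) - 1 / 2)) * legendre (k.1 - 1) := by
  have hk : k.1 - 1 = (k.1 - 2) + 1 := by have := k.2; omega
  rw [etaPoly, legendre, derivative_C_mul, ← Function.iterate_succ_apply' derivative,
    show (k.1 - 2).succ = k.1 - 1 from hk.symm, ← mul_assoc, ← C_mul, neg_mul]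

theorem etaFun_eq_etaPoly (k : N2) {x : ℝ} (hx : x ∈ Icc (-1 : ℝ) 1) :
    etaFun k x = (etaPoly k).eval x := by
  by_cases h : x ∈ Ioo (-1 : ℝ) 1
  · have hd : ∀ s ∈ uIcc x 1, HasDerivAt (fun y => (etaPoly k).eval y)
        (-Real.sqrt ((k.1 : ℝ) - 1 / 2) * (legendre (k.1 - 1)).eval s) s := by
      intro s _
      have := (etaPoly k).hasDerivAt s
      rwa [derivative_etaPoly, eval_mul, eval_C] at this
    have hI := intervalIntegral.integral_eq_sub_of_hasDerivAt hd
      ((continuous_const.mul (legendre (k.1 - 1)).continuous).intervalIntegrable _ _)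
    rw [intervalIntegral.integral_const_mul, etaPoly_eval_eq_zero k (by norm_num)] at hI
    rw [etaFun, if_pos h]
    linarith
  · rw [etaFun, if_neg h]
    have : x = -1 ∨ x = 1 := by
      by_contra! hc
      exact h ⟨lt_of_le_of_ne hx.1 (Ne.symm hc.1), lt_of_le_of_ne hx.2 hc.2⟩
    rcases this with rfl | rfl <;> rw [etaPoly_eval_eq_zero k (by norm_num)]

/-- The Babuška–Shen basis function `η_k` as an element of `H¹₀(-1,1)`. -/
def eta (k : N2) : H10 :=
  ⟨etaFun k, by
    refine ⟨?_, ?_, fun x hx => if_neg hx⟩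
    · refine ContDiffOn.absolutelyContinuousOnInterval ?_
      refine ((Polynomial.contDiff_aeval (𝕜 := ℝ) (etaPoly k) 1).contDiffOn).congr fun x hx => ?_
      rw [uIcc_of_le (by norm_num)] at hx
      rw [etaFun_eq_etaPoly k hx, coe_aeval_eq_eval]
    · have hb : MemLp (fun x => (derivative (etaPoly k)).eval x) 2 muI := by
        obtain ⟨M, hM⟩ := (isCompact_Icc (a := (-1 : ℝ)) (b := 1)).exists_bound_of_continuousOn
          (derivative (etaPoly k)).continuous.continuousOn
        refine MemLp.of_bound (derivative (etaPoly k)).continuous.aestronglyMeasurable M ?_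
        rw [ae_restrict_iff' measurableSet_Ioo]
        exact Filter.Eventually.of_forall fun x hx => hM x (Ioo_subset_Icc_self hx)
      refine hb.ae_eq ?_
      rw [Filter.EventuallyEq, ae_restrict_iff' measurableSet_Ioo]
      refine Filter.Eventually.of_forall fun x hx => ?_
      have he : etaFun k =ᶠ[nhds x] fun y => (etaPoly k).eval y := by
        filter_upwards [isOpen_Ioo.mem_nhds hx] with y hy
        exact etaFun_eq_etaPoly k (Ioo_subset_Icc_self hy)
      rw [he.deriv_eq]
      exact ((etaPoly k).deriv (x := x)).symm⟩

/-- The coefficient `v̂_k = ∫ Dv Dη_k` of `v ∈ H¹₀`. -/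
def coeff (v : H10) (k : N2) : ℝ := inner ℝ v (eta k)

/-- The dual basis functional `η_k^*`, `⟨η_k^*, v⟩ = v̂_k`. -/
def etaDual (k : N2) : Hm1 := innerSL ℝ (eta k)

theorem etaDual_apply (k : N2) (v : H10) : etaDual k v = coeff v k := by
  rw [etaDual, innerSL_apply_apply, coeff, real_inner_comm]

/-- The subspace `V_Λ = span {η_k : k ∈ Λ}`. -/
def VLam (S : Finset N2) : Submodule ℝ H10 := Submodule.span ℝ (eta '' (S : Set N2))

/-- The projection `P_Λ v = ∑_{k ∈ Λ} v̂_k η_k` of a function. -/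
def proj (S : Finset N2) (v : H10) : H10 := ∑ k ∈ S, coeff v k • eta k

/-- The projection `P_Λ f = ∑_{k ∈ Λ} f̂_k η_k^*`, `f̂_k = ⟨f, η_k⟩`, of a functional. -/
def projDual (S : Finset N2) (f : Hm1) : Hm1 := ∑ k ∈ S, f (eta k) • etaDual k

/-! ### Sparsity classes of exponential type -/

/-- The best `N`-term approximation error `E_N(v)` of a function, in the `H¹₀`-norm. -/
def bestErr (v : H10) (N : ℕ) : ℝ := ⨅ S : {S : Finset N2 // S.card = N}, ‖v - proj S.1 v‖

/-- The best `N`-term approximation error `E_N(f)` of a functional, in the `H⁻¹`-norm. -/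
def bestErrDual (f : Hm1) (N : ℕ) : ℝ := ⨅ S : {S : Finset N2 // S.card = N}, ‖f - projDual S.1 f‖

/-- Membership in the class `𝒜_G^{η,t}`, for an object with best `N`-term errors `E N`:
the supremum of `E N * exp (η N^t)` over `N ≥ 0` is finite. -/
def InClass (E : ℕ → ℝ) (η t : ℝ) : Prop :=
  BddAbove (Set.range fun N : ℕ => E N * Real.exp (η * (N : ℝ) ^ t))

/-- The quantity `‖·‖_{𝒜_G^{η,t}} = sup_{N ≥ 0} E N * exp (η N^t)`. -/
def classNorm (E : ℕ → ℝ) (η t : ℝ) : ℝ :=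
  ⨆ N : ℕ, E N * Real.exp (η * (N : ℝ) ^ t)

/-! ### The elliptic problem -/

/-- Coefficients of the operator `L v = -D(ν Dv) + σ v` on `(-1,1)`, with bounds
`0 < ν_* ≤ ν ≤ ν^*` and `0 ≤ σ ≤ σ^*`. -/
structure EllipticData where
  ν : ℝ → ℝ
  σ : ℝ → ℝ
  nuLo : ℝ
  nuHi : ℝ
  sigHi : ℝ
  nu_meas : AEStronglyMeasurable ν muI
  sigma_meas : AEStronglyMeasurable σ muI
  nuLo_pos : 0 < nuLo
  nuLo_le : ∀ x ∈ Ioo (-1 : ℝ) 1, nuLo ≤ ν x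
  le_nuHi : ∀ x ∈ Ioo (-1 : ℝ) 1, ν x ≤ nuHi
  sigma_nonneg : ∀ x ∈ Ioo (-1 : ℝ) 1, 0 ≤ σ x
  le_sigHi : ∀ x ∈ Ioo (-1 : ℝ) 1, σ x ≤ sigHi

namespace EllipticData

variable (P : EllipticData)

/-- `α_* = ν_*`. -/
def alphaLo : ℝ := P.nuLo

/-- `α^* = max (ν^*, σ^*)`. -/
def alphaHi : ℝ := max P.nuHi P.sigHi

/-- The bilinear form `a(v,w) = ∫ ν Dv Dw + ∫ σ v w`. -/
def form (v w : H10) : ℝ :=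
  (∫ x, P.ν x * (v.D x * w.D x) ∂muI) + ∫ x, P.σ x * (v x * w x) ∂muI

theorem integrable_nu (v w : H10) : Integrable (fun x => P.ν x * (v.D x * w.D x)) muI := by
  refine (v.integrable_D_mul_D w).bdd_mul (c := P.nuHi) P.nu_meas ?_
  rw [ae_restrict_iff' measurableSet_Ioo]
  refine Filter.Eventually.of_forall fun x hx => ?_
  rw [Real.norm_eq_abs, abs_of_nonneg (P.nuLo_pos.le.trans (P.nuLo_le x hx))]
  exact P.le_nuHi x hx

theorem integrable_mul (v w : H10) : Integrable (fun x => v x * w x) muI := by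
  refine Integrable.of_bound
    ((v.continuousOn.mul w.continuousOn).aestronglyMeasurable measurableSet_Ioo)
    ((2 * ‖v‖) * (2 * ‖w‖)) (Filter.Eventually.of_forall fun x => ?_)
  rw [norm_mul]
  exact mul_le_mul (v.abs_apply_le x) (w.abs_apply_le x) (norm_nonneg _) (by positivity)

theorem integrable_sigma (v w : H10) : Integrable (fun x => P.σ x * (v x * w x)) muI := by
  refine (integrable_mul v w).bdd_mul (c := P.sigHi) P.sigma_meas ?_
  rw [ae_restrict_iff' measurableSet_Ioo]
  refine Filter.Eventually.of_forall fun x hx => ?_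
  rw [Real.norm_eq_abs, abs_of_nonneg (P.sigma_nonneg x hx)]
  exact P.le_sigHi x hx

theorem form_comm (v w : H10) : P.form v w = P.form w v := by
  unfold form
  congr 2 <;> funext x <;> ring

theorem form_add_left (v w z : H10) : P.form (v + w) z = P.form v z + P.form w z := by
  have h1 : (∫ x, P.ν x * ((v + w).D x * z.D x) ∂muI) =
      (∫ x, P.ν x * (v.D x * z.D x) ∂muI) + ∫ x, P.ν x * (w.D x * z.D x) ∂muI := by
    rw [← integral_add (P.integrable_nu v z) (P.integrable_nu w z)]
    refine integral_congr_ae ?_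
    filter_upwards [H10.ae_D_add v w] with x hx
    rw [hx, Pi.add_apply]
    ring
  have h2 : (∫ x, P.σ x * ((v + w) x * z x) ∂muI) =
      (∫ x, P.σ x * (v x * z x) ∂muI) + ∫ x, P.σ x * (w x * z x) ∂muI := by
    rw [← integral_add (P.integrable_sigma v z) (P.integrable_sigma w z)]
    congr 1
    funext x
    change P.σ x * ((v x + w x) * z x) = _
    ring
  rw [form, h1, h2, form, form]
  ring

theorem form_smul_left (c : ℝ) (v w : H10) : P.form (c • v) w = c * P.form v w := by
  have h1 : (∫ x, P.ν x * ((c • v).D x * w.D x) ∂muI) =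
      c * ∫ x, P.ν x * (v.D x * w.D x) ∂muI := by
    rw [← integral_const_mul]
    congr 1
    funext x
    rw [H10.D_smul, Pi.smul_apply, smul_eq_mul]
    ring
  have h2 : (∫ x, P.σ x * ((c • v) x * w x) ∂muI) = c * ∫ x, P.σ x * (v x * w x) ∂muI := by
    rw [← integral_const_mul]
    congr 1
    funext x
    change P.σ x * ((c * v x) * w x) = _
    ring
  rw [form, h1, h2, form]
  ring

theorem sigHi_nonneg : 0 ≤ P.sigHi :=
  (P.sigma_nonneg 0 (by norm_num)).trans (P.le_sigHi 0 (by norm_num))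

theorem nuHi_nonneg : 0 ≤ P.nuHi :=
  (P.nuLo_pos.le.trans (P.nuLo_le 0 (by norm_num))).trans (P.le_nuHi 0 (by norm_num))

theorem abs_form_le (v w : H10) : ‖P.form v w‖ ≤ (P.nuHi + 8 * P.sigHi) * ‖v‖ * ‖w‖ := by
  have h1 : ‖∫ x, P.ν x * (v.D x * w.D x) ∂muI‖ ≤ P.nuHi * (‖v‖ * ‖w‖) := by
    have hi : Integrable (fun x => ‖v.D x‖ * ‖w.D x‖) muI := by
      simpa only [norm_mul] using (v.integrable_D_mul_D w).norm
    calc ‖∫ x, P.ν x * (v.D x * w.D x) ∂muI‖ ≤ ∫ x, P.nuHi * (‖v.D x‖ * ‖w.D x‖) ∂muI := by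
          refine norm_integral_le_of_norm_le (hi.const_mul _) ?_
          rw [ae_restrict_iff' measurableSet_Ioo]
          refine Filter.Eventually.of_forall fun x hx => ?_
          rw [norm_mul, norm_mul, Real.norm_eq_abs (P.ν x),
            abs_of_nonneg (P.nuLo_pos.le.trans (P.nuLo_le x hx))]
          exact mul_le_mul_of_nonneg_right (P.le_nuHi x hx) (by positivity)
      _ ≤ _ := by
          rw [integral_const_mul]
          exact mul_le_mul_of_nonneg_left (v.integral_norm_D_mul_le w) P.nuHi_nonneg
  have h2 : ‖∫ x, P.σ x * (v x * w x) ∂muI‖ ≤ 8 * P.sigHi * (‖v‖ * ‖w‖) := by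
    have := norm_setIntegral_le_of_norm_le_const (μ := volume) (s := Ioo (-1 : ℝ) 1)
      (f := fun x => P.σ x * (v x * w x)) (C := P.sigHi * ((2 * ‖v‖) * (2 * ‖w‖)))
      (by simp) (fun x hx => by
        rw [norm_mul, norm_mul, Real.norm_eq_abs (P.σ x), abs_of_nonneg (P.sigma_nonneg x hx)]
        refine mul_le_mul (P.le_sigHi x hx) ?_ (by positivity) P.sigHi_nonneg
        exact mul_le_mul (v.abs_apply_le x) (w.abs_apply_le x) (norm_nonneg _) (by positivity))
    refine this.trans (le_of_eq ?_)
    have hv : volume.real (Ioo (-1 : ℝ) 1) = 2 := by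
      simp [Measure.real]
      norm_num
    rw [hv]
    ring
  rw [form]
  refine (norm_add_le _ _).trans ((add_le_add h1 h2).trans (le_of_eq ?_))
  ring

/-- The operator `L : H¹₀ → H⁻¹`, `⟨L v, w⟩ = a(v,w)`. -/
def L : H10 →L[ℝ] Hm1 :=
  LinearMap.mkContinuous₂
    (LinearMap.mk₂ ℝ P.form P.form_add_left P.form_smul_left
      (fun v w z => by
        rw [P.form_comm, P.form_add_left, P.form_comm w, P.form_comm z])
      (fun c v w => by
        rw [P.form_comm, P.form_smul_left, P.form_comm w, smul_eq_mul]))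
    (P.nuHi + 8 * P.sigHi) P.abs_form_le

theorem L_apply (v w : H10) : P.L v w = P.form v w := rfl

/-- `u` is the weak solution of `L u = f`. -/
def IsSolution (f : Hm1) (u : H10) : Prop := ∀ v : H10, P.form u v = f v

/-- `w` is the Galerkin solution `u_Λ` in `V_Λ`. -/
def IsGalerkin (f : Hm1) (S : Finset N2) (w : H10) : Prop :=
  w ∈ VLam S ∧ ∀ v ∈ VLam S, P.form w v = f v

/-- The residual `r(w) = f - L w ∈ H⁻¹`. -/
def residual (f : Hm1) (w : H10) : Hm1 := f - P.L w

/-- The stiffness matrix `A = (a(η_n, η_m))_{m,n ≥ 2}`. -/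
def stiffness : Matrix N2 N2 ℝ := fun m n => P.form (eta n) (eta m)

end EllipticData

/-! ### Infinite matrices -/

/-- The space of square summable real sequences indexed by `k ≥ 2`. -/
abbrev Seq2 : Type := lp (fun _ : N2 => ℝ) 2

/-- The bounded operator `T` on `ℓ²` is represented by the infinite matrix `M`. -/
def Represents (T : Seq2 →L[ℝ] Seq2) (M : Matrix N2 N2 ℝ) : Prop :=
  ∀ m n : N2, (T (lp.single 2 n (1 : ℝ))) m = M m n

/-- `A` defines a boundedly invertible operator on `ℓ²`, and `B` is the matrix of the inverse. -/
def IsInverse (A B : Matrix N2 N2 ℝ) : Prop :=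
  ∃ T S : Seq2 →L[ℝ] Seq2, Represents T A ∧ Represents S B ∧
    T.comp S = ContinuousLinearMap.id ℝ Seq2 ∧ S.comp T = ContinuousLinearMap.id ℝ Seq2

/-- `M` defines a bounded operator on `ℓ²` of norm at most `c`. -/
def OpNormLe (M : Matrix N2 N2 ℝ) (c : ℝ) : Prop :=
  ∃ T : Seq2 →L[ℝ] Seq2, Represents T M ∧ ‖T‖ ≤ c

/-- The symmetric truncation `M_J`: entries with `|m - n| > J` are replaced by zero. -/
def trunc (J : ℕ) (M : Matrix N2 N2 ℝ) : Matrix N2 N2 ℝ := fun m n =>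
  if |(m.1 : ℤ) - (n.1 : ℤ)| ≤ (J : ℤ) then M m n else 0

/-- The exponential class `𝒟_e(γ)`: off-diagonal decay with rate `γ`. -/
def ExpClass (M : Matrix N2 N2 ℝ) (γ : ℝ) : Prop :=
  ∃ c : ℝ, 0 < c ∧ ∀ m n : N2, |M m n| ≤ c * Real.exp (-γ * |(m.1 : ℝ) - (n.1 : ℝ)|)

/-! ### The procedures and the algorithm -/

/-- `S` is an output of **DÖRFLER**`(r, θ)`. -/
def IsDorfler (r : Hm1) (θ : ℝ) (S : Finset N2) : Prop :=
  θ * ‖r‖ ≤ ‖projDual S r‖ ∧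
    ∀ S' : Finset N2, θ * ‖r‖ ≤ ‖projDual S' r‖ → S.card ≤ S'.card

/-- **ENRICH**`(S, J)`: all indices at distance at most `J` from `S`. -/
def enrich (S : Finset N2) (J : ℕ) : Finset N2 :=
  S.biUnion fun l => (Finset.Icc (l.1 - J) (l.1 + J)).subtype fun k => 2 ≤ k

theorem mem_enrich (S : Finset N2) (J : ℕ) (k : N2) :
    k ∈ enrich S J ↔ ∃ l ∈ S, |(k.1 : ℤ) - (l.1 : ℤ)| ≤ (J : ℤ) := by
  simp only [enrich, Finset.mem_biUnion, Finset.mem_subtype, Finset.mem_Icc, abs_le]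
  refine exists_congr fun l => and_congr_right fun _ => ?_
  omega

/-- `J_θ`: the least positive integer `J` with `C e^{-γ J} ≤ √((1-θ²)/(α_* α^*))`. -/
def enrichRadius (P : EllipticData) (C γ θ : ℝ) : ℕ :=
  sInf {J : ℕ | 0 < J ∧
    C * Real.exp (-γ * (J : ℝ)) ≤ Real.sqrt ((1 - θ ^ 2) / (P.alphaLo * P.alphaHi))}

/-- `S` is an output of **COARSE**`(w, ε)`, where `w ∈ V_{S₀}`. -/
def IsCoarse (S₀ : Finset N2) (w : H10) (ε : ℝ) (S : Finset N2) : Prop :=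
  S ⊆ S₀ ∧ ‖w - proj S w‖ ≤ 2 * ε ∧
    ∀ S' : Finset N2, S' ⊆ S₀ → ‖w - proj S' w‖ ≤ 2 * ε → S.card ≤ S'.card

/-- The first `M` iterations of **PC-ADLEG**`(θ, tol)` with right-hand side `f` and enrichment
radius `J`, with arbitrary choices among the admissible outputs of **DÖRFLER** and **COARSE**.
`Lam n`, `u n` are `Λ_n`, `u_n`; `LamHat n`, `uHat n` are the predictor set and its Galerkin
solution (for `n ≥ 1`). A further iteration is started only if the last residual exceeds `tol`. -/
structure IsRun (P : EllipticData) (f : Hm1) (θ tol : ℝ) (J M : ℕ)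
    (Lam LamHat : ℕ → Finset N2) (u uHat : ℕ → H10) : Prop where
  init_set : Lam 0 = ∅
  init_sol : u 0 = 0
  not_stopped : ∀ n, 0 < n → n < M → tol < ‖P.residual f (u n)‖
  predictor_set : ∀ n, n < M → ∃ S : Finset N2, IsDorfler (P.residual f (u n)) θ S ∧
    LamHat (n + 1) = Lam n ∪ enrich S J
  predictor_sol : ∀ n, n < M → P.IsGalerkin f (LamHat (n + 1)) (uHat (n + 1))
  corrector_set : ∀ n, n < M → IsCoarse (LamHat (n + 1)) (uHat (n + 1))
    (2 / P.alphaLo * Real.sqrt (1 - θ ^ 2) * ‖P.residual f (u n)‖) (Lam (n + 1))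
  corrector_sol : ∀ n, n < M → P.IsGalerkin f (Lam (n + 1)) (u (n + 1))

end PCADLEG

end

open PCADLEG

/-! The Babuška–Shen functions form a Hilbert basis of `H10`: their derivatives are multiples of
Legendre polynomials, which are orthogonal and, together with the constant, span all polynomials.
Projection errors are thus tails of sums of squares, and the Riesz isometry moves every statement
about `Hm1` to `H10`.

Active sets. Put `β = √(1 - θ²) ‖r_n‖ / α_*`. Dörfler marking discards a part of the residual of
norm at most `√(1 - θ²) ‖r_n‖`, and replacing the inverse matrix by its band of width `J_θ` costs an
error of the same size in the energy norm. The predictor is therefore within `13/4 β` of `u`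
(`predictor_error_le`). Coarsening tolerates `4 β`, so any index set resolving `u` to `β / 2` is,
after intersection with the predictor set, a competitor, and minimality bounds `|Λ_{n+1}|` by its
size. The new error is at most a constant times `β` (`IsRun.step`), so the sparsity class, applied
at accuracy `β / 2`, gives the bound whatever the previous history of the run.

Optimality. For squared coefficients `K² (g j - g (j + 1))` with `g j = exp (-2 η j^t)` the tails
telescope. Since `t ≤ 1`, `g` is convex, so the coefficients decrease, the first `N` of them are the
best ones, and the error is exactly `K exp (-η N^t)`.

Predictor sets. The Galerkin residual depends linearly on `u`. For `u = η_k` its coefficients decay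
exponentially away from `k`, uniformly in `Λ` (`exists_residual_decay`): exponential weights are
inserted into the Galerkin equations, and the commutator is absorbed by coercivity when the weight
grows slowly. Approximating `u` by `N` terms and keeping a neighbourhood of radius `N` around each
index approximates every residual with `O(N²)` terms, which halves the exponent `t`. Minimality in
Dörfler marking then bounds the marked set, and the factor `2 J_θ + 1` from enrichment is absorbed
by lowering the rate. -/

noncomputable section

namespace PCADLEG

/-! ### Orthogonality of the Legendre polynomials -/

theorem natDegree_X_sq_sub_one_pow (n : ℕ) : ((X ^ 2 - 1 : ℝ[X]) ^ n).natDegree = 2 * n := by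
  rw [natDegree_pow, show (1 : ℝ[X]) = C 1 by simp, natDegree_X_pow_sub_C, mul_comm]

theorem monic_X_sq_sub_one_pow (n : ℕ) : ((X ^ 2 - 1 : ℝ[X]) ^ n).Monic := by
  refine Monic.pow ?_ n
  have := monic_X_pow_sub_C (R := ℝ) (1 : ℝ) (n := 2) (by norm_num)
  simpa using this

theorem eval_iterate_derivative_eq_zero {n j : ℕ} (hj : j < n) {a : ℝ} (ha : a ^ 2 = 1) :
    (derivative^[j] ((X ^ 2 - 1 : ℝ[X]) ^ n)).eval a = 0 := by
  have h := pow_sub_dvd_iterate_derivative_pow (X ^ 2 - 1 : ℝ[X]) n j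
  obtain ⟨q, hq⟩ := h
  rw [hq, eval_mul]
  have : (eval a ((X ^ 2 - 1 : ℝ[X]) ^ (n - j))) = 0 := by
    rw [eval_pow]
    simp only [eval_sub, eval_pow, eval_X, eval_one, ha, sub_self]
    exact zero_pow (by omega)
  rw [this, zero_mul]

theorem integral_derivative_mul (p q : ℝ[X]) (h1 : p.eval 1 = 0) (h2 : p.eval (-1) = 0) :
    ∫ x in (-1 : ℝ)..1, (derivative p).eval x * q.eval x =
      -∫ x in (-1 : ℝ)..1, p.eval x * (derivative q).eval x := by
  have h := intervalIntegral.integral_mul_deriv_eq_deriv_mul (a := -1) (b := 1)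
    (fun x _ => q.hasDerivAt x) (fun x _ => p.hasDerivAt x)
    ((derivative q).continuous.intervalIntegrable _ _)
    ((derivative p).continuous.intervalIntegrable _ _)
  simp only [h1, h2, mul_zero, sub_zero, zero_sub] at h
  simp only [mul_comm _ (eval _ q), mul_comm _ (eval _ (derivative q))]
  exact h

/-- Each integration by parts has no boundary terms, because derivatives of order below `n` of `(x²
- 1)^n` still vanish at both end points. -/
theorem integral_rodrigues_mul (n : ℕ) (q : ℝ[X]) (i : ℕ) (hi : i ≤ n) :
    ∫ x in (-1 : ℝ)..1, (derivative^[n] ((X ^ 2 - 1) ^ n)).eval x * q.eval x =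
      (-1) ^ i * ∫ x in (-1 : ℝ)..1,
        (derivative^[n - i] ((X ^ 2 - 1) ^ n)).eval x * (derivative^[i] q).eval x := by
  induction i with
  | zero => simp
  | succ i ih =>
    rw [ih (by omega), show n - i = (n - (i + 1)) + 1 by omega, Function.iterate_succ_apply',
      integral_derivative_mul _ _ (eval_iterate_derivative_eq_zero (by omega) (by norm_num))
        (eval_iterate_derivative_eq_zero (by omega) (by norm_num)),
      Function.iterate_succ_apply' derivative i, pow_succ]
    ring

theorem integral_legendre_mul (n : ℕ) (q : ℝ[X]) :
    ∫ x in (-1 : ℝ)..1, (legendre n).eval x * q.eval x =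
      1 / (2 ^ n * (n.factorial : ℝ)) * ((-1) ^ n *
        ∫ x in (-1 : ℝ)..1, ((X ^ 2 - 1 : ℝ[X]) ^ n).eval x * (derivative^[n] q).eval x) := by
  have h := integral_rodrigues_mul n q n le_rfl
  rw [Nat.sub_self, Function.iterate_zero_apply] at h
  rw [← h, ← intervalIntegral.integral_const_mul]
  simp only [legendre, eval_mul, eval_C, mul_assoc]

theorem degree_legendre (n : ℕ) : (legendre n).degree = n := by
  have hc : (1 / (2 ^ n * (n.factorial : ℝ))) ≠ 0 := by positivity
  rw [legendre, degree_C_mul hc]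
  refine le_antisymm ?_ (le_degree_of_ne_zero ?_)
  · refine degree_le_of_natDegree_le ?_
    refine (natDegree_iterate_derivative _ n).trans ?_
    rw [natDegree_X_sq_sub_one_pow]
    omega
  · rw [coeff_iterate_derivative]
    have h := (monic_X_sq_sub_one_pow n).coeff_natDegree
    rw [natDegree_X_sq_sub_one_pow, two_mul] at h
    rw [h]
    have : (n + n).descFactorial n ≠ 0 := by
      rw [Ne, Nat.descFactorial_eq_zero_iff_lt]
      omega
    simp [this]

theorem integral_legendre_mul_legendre_of_lt {m n : ℕ} (h : m < n) :
    ∫ x in (-1 : ℝ)..1, (legendre n).eval x * (legendre m).eval x = 0 := by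
  rw [integral_legendre_mul, iterate_derivative_eq_zero_of_degree_lt]
  · simp
  · rw [degree_legendre]
    exact_mod_cast h

/-- Integrate the derivative of `x (x² - 1)^(n+1)`, which vanishes at `±1`, after writing `x² = (x²
- 1) + 1`. -/
theorem integral_X_sq_sub_one_pow_succ (n : ℕ) :
    (2 * n + 3) * ∫ x in (-1 : ℝ)..1, ((X ^ 2 - 1 : ℝ[X]) ^ (n + 1)).eval x =
      -(2 * (n + 1)) * ∫ x in (-1 : ℝ)..1, ((X ^ 2 - 1 : ℝ[X]) ^ n).eval x := by
  have h := intervalIntegral.integral_eq_sub_of_hasDerivAt (a := -1) (b := 1)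
    (fun x _ => (X * (X ^ 2 - 1 : ℝ[X]) ^ (n + 1)).hasDerivAt x)
    ((derivative (X * (X ^ 2 - 1 : ℝ[X]) ^ (n + 1))).continuous.intervalIntegrable _ _)
  have hd : ∀ x : ℝ, (derivative (X * (X ^ 2 - 1 : ℝ[X]) ^ (n + 1))).eval x =
      (2 * n + 3) * ((X ^ 2 - 1 : ℝ[X]) ^ (n + 1)).eval x +
        (2 * (n + 1)) * ((X ^ 2 - 1 : ℝ[X]) ^ n).eval x := by
    intro x
    rw [derivative_mul, derivative_X, derivative_pow_succ]
    simp only [eval_add, eval_mul, eval_pow, eval_sub, eval_X, eval_one, eval_C, map_sub,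
      derivative_X_sq, derivative_one, pow_succ _ n, eval_zero]
    ring
  simp only [hd] at h
  rw [intervalIntegral.integral_add, intervalIntegral.integral_const_mul,
    intervalIntegral.integral_const_mul] at h
  · simp at h
    simp
    linarith
  · exact (continuous_const.mul (Polynomial.continuous _)).intervalIntegrable _ _
  · exact (continuous_const.mul (Polynomial.continuous _)).intervalIntegrable _ _

theorem integral_X_sq_sub_one_pow (n : ℕ) :
    (2 * n + 1) * ((-1) ^ n * ((2 * n).factorial : ℝ) *
      ∫ x in (-1 : ℝ)..1, ((X ^ 2 - 1 : ℝ[X]) ^ n).eval x) = 2 * (2 ^ n * (n.factorial : ℝ)) ^ 2 := by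
  induction n with
  | zero => norm_num
  | succ n ih =>
    have h := integral_X_sq_sub_one_pow_succ n
    have hf : ((2 * (n + 1)).factorial : ℝ) =
        (2 * n + 2) * ((2 * n + 1) * ((2 * n).factorial : ℝ)) := by
      rw [show 2 * (n + 1) = (2 * n + 1) + 1 by ring, Nat.factorial_succ, Nat.factorial_succ]
      push_cast
      ring
    rw [hf, Nat.factorial_succ]
    push_cast
    set W := ∫ x in (-1 : ℝ)..1, ((X ^ 2 - 1 : ℝ[X]) ^ n).eval x
    set W' := ∫ x in (-1 : ℝ)..1, ((X ^ 2 - 1 : ℝ[X]) ^ (n + 1)).eval x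
    calc _ = (-1) ^ (n + 1) * ((2 * n + 2) * ((2 * n + 1) * ((2 * n).factorial : ℝ))) *
          ((2 * n + 3) * W') := by ring
      _ = 4 * (n + 1 : ℝ) ^ 2 * ((2 * n + 1) * ((-1) ^ n * ((2 * n).factorial : ℝ) * W)) := by
        rw [h]; ring
      _ = _ := by rw [ih]; ring

theorem integral_legendre_mul_self (n : ℕ) :
    ∫ x in (-1 : ℝ)..1, (legendre n).eval x * (legendre n).eval x = 2 / (2 * n + 1) := by
  -- Only the leading term of the monic polynomial `(x² - 1)^n` survives `2 n` derivatives, so one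
  -- factor becomes a constant.
  have hD : derivative^[n] (legendre n) = C (1 / (2 ^ n * (n.factorial : ℝ)) * (2 * n).factorial) := by
    rw [legendre, iterate_derivative_C_mul, ← Function.iterate_add_apply, ← two_mul, C_mul]
    congr 1
    refine Polynomial.ext fun k => ?_
    rw [coeff_iterate_derivative, coeff_C]
    split_ifs with hk
    · subst hk
      have h := (monic_X_sq_sub_one_pow n).coeff_natDegree
      rw [natDegree_X_sq_sub_one_pow] at h
      rw [zero_add, h, Nat.descFactorial_self]
      simp
    · rw [coeff_eq_zero_of_natDegree_lt, smul_zero]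
      rw [natDegree_X_sq_sub_one_pow]
      omega
  have h := integral_X_sq_sub_one_pow n
  rw [integral_legendre_mul, hD]
  simp only [eval_C]
  rw [intervalIntegral.integral_mul_const]
  set W := ∫ x in (-1 : ℝ)..1, ((X ^ 2 - 1 : ℝ[X]) ^ n).eval x
  have h1 : (2 * (n : ℝ) + 1) ≠ 0 := by positivity
  have h2 : (2 ^ n * (n.factorial : ℝ)) ≠ 0 := by positivity
  rw [eq_div_iff h1]
  field_simp
  rw [← mul_pow]
  linarith

/-! ### The basis functions are orthonormal -/

theorem D_eta (k : N2) {x : ℝ} (hx : x ∈ Ioo (-1 : ℝ) 1) :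
    (eta k).D x = -Real.sqrt ((k.1 : ℝ) - 1 / 2) * (legendre (k.1 - 1)).eval x := by
  have he : etaFun k =ᶠ[nhds x] fun y => (etaPoly k).eval y := by
    filter_upwards [isOpen_Ioo.mem_nhds hx] with y hy
    exact etaFun_eq_etaPoly k (Ioo_subset_Icc_self hy)
  change deriv (etaFun k) x = _
  rw [he.deriv_eq, (etaPoly k).deriv, derivative_etaPoly, eval_mul, eval_C]

theorem integral_muI (g : ℝ → ℝ) : ∫ x, g x ∂muI = ∫ x in (-1 : ℝ)..1, g x := by
  rw [intervalIntegral.integral_of_le (by norm_num), integral_Ioc_eq_integral_Ioo]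

theorem inner_eta (v : H10) (k : N2) :
    inner ℝ v (eta k) = -Real.sqrt ((k.1 : ℝ) - 1 / 2) *
      ∫ x, v.D x * (legendre (k.1 - 1)).eval x ∂muI := by
  rw [H10.inner_def, ← integral_const_mul]
  refine setIntegral_congr_fun measurableSet_Ioo fun x hx => ?_
  simp only [D_eta k hx]
  ring

theorem orthonormal_eta : Orthonormal ℝ eta := by
  classical
  rw [orthonormal_iff_ite]
  intro i j
  have key : inner ℝ (eta i) (eta j) = Real.sqrt ((i.1 : ℝ) - 1 / 2) *
      Real.sqrt ((j.1 : ℝ) - 1 / 2) *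
      ∫ x in (-1 : ℝ)..1, (legendre (i.1 - 1)).eval x * (legendre (j.1 - 1)).eval x := by
    rw [← integral_muI, ← integral_const_mul, H10.inner_def]
    refine setIntegral_congr_fun measurableSet_Ioo fun x hx => ?_
    simp only [D_eta _ hx]
    ring
  rw [key]
  have hi := i.2
  have hj := j.2
  split_ifs with hij
  · subst hij
    have h2 : (2 : ℝ) ≤ i.1 := by exact_mod_cast hi
    rw [integral_legendre_mul_self, Real.mul_self_sqrt (by linarith), Nat.cast_sub (by omega)]
    push_cast
    rw [show 2 * ((i.1 : ℝ) - 1) + 1 = 2 * ((i.1 : ℝ) - 1 / 2) by ring]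
    have : (i.1 : ℝ) - 1 / 2 ≠ 0 := by linarith
    rw [mul_div_assoc', mul_comm, div_self (mul_ne_zero two_ne_zero this)]
  · rcases lt_or_gt_of_ne (fun h => hij (Subtype.ext h) : i.1 ≠ j.1) with h | h
    · simp only [mul_comm (eval _ (legendre (i.1 - 1)))]
      rw [integral_legendre_mul_legendre_of_lt (by omega), mul_zero]
    · rw [integral_legendre_mul_legendre_of_lt (by omega), mul_zero]

/-! ### Completeness of `H¹₀(-1,1)` -/

namespace H10

/-- The derivative as an isometry from `H¹₀(-1,1)` into `L²(-1,1)`. -/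
def toL2 : H10 →ₗᵢ[ℝ] Lp ℝ 2 muI where
  toFun v := v.memLp_D.toLp v.D
  map_add' v w := by
    rw [← MemLp.toLp_add, MemLp.toLp_eq_toLp_iff]
    exact ae_D_add v w
  map_smul' c v := by
    rw [RingHom.id_apply, ← MemLp.toLp_const_smul, MemLp.toLp_eq_toLp_iff, D_smul]
  norm_map' v := by
    have h : ‖v.memLp_D.toLp v.D‖ ^ 2 = ‖v‖ ^ 2 := by
      rw [← real_inner_self_eq_norm_sq, L2.inner_def, norm_sq]
      refine integral_congr_ae ?_
      filter_upwards [v.memLp_D.coeFn_toLp] with x hx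
      simp [hx, sq]
    exact (sq_eq_sq₀ (norm_nonneg _) (norm_nonneg _)).1 h

theorem integral_D (v : H10) : ∫ x, v.D x ∂muI = 0 := by
  rw [integral_muI, ← eq_integral_D v (by norm_num)]
  exact v.2.2.2 1 (by simp)

/-- The primitive of a square integrable function with vanishing mean value. -/
theorem exists_D_ae_eq {g : ℝ → ℝ} (hg : MemLp g 2 muI) (h0 : ∫ x, g x ∂muI = 0) :
    ∃ v : H10, v.D =ᵐ[muI] g := by
  classical
  set G : ℝ → ℝ := fun x => ∫ s in (-1 : ℝ)..x, g s with hG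
  have hint : IntervalIntegrable g volume (-1) 1 := by
    rw [intervalIntegrable_iff_integrableOn_Ioo_of_le (by norm_num)]
    exact hg.integrable (by norm_num)
  have hac := hint.absolutelyContinuousOnInterval_intervalIntegral (c := -1) (by simp)
  -- The extension by zero required in `H10` does not change the primitive on the closed interval:
  -- it vanishes at `-1` by construction and at `1` by the mean value condition.
  set F : ℝ → ℝ := fun x => if x ∈ Ioo (-1 : ℝ) 1 then G x else 0 with hF
  have hFG : ∀ x ∈ uIcc (-1 : ℝ) 1, G x = F x := by
    intro x hx
    rw [uIcc_of_le (by norm_num)] at hx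
    by_cases h : x ∈ Ioo (-1 : ℝ) 1
    · simp only [hF, if_pos h]
    · simp only [hF, if_neg h]
      have : x = -1 ∨ x = 1 := by
        by_contra! hc
        exact h ⟨lt_of_le_of_ne hx.1 (Ne.symm hc.1), lt_of_le_of_ne hx.2 hc.2⟩
      rcases this with rfl | rfl
      · simp [hG]
      · rw [hG]
        simpa only [← integral_muI] using h0
  have hFac : AbsolutelyContinuousOnInterval F (-1) 1 := by
    rw [absolutelyContinuousOnInterval_iff] at hac ⊢
    intro ε hε
    obtain ⟨δ, hδ, h⟩ := hac ε hε
    refine ⟨δ, hδ, fun E hE hlt => ?_⟩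
    refine lt_of_eq_of_lt (Finset.sum_congr rfl fun i hi => ?_) (h E hE hlt)
    have := hE.1 i hi
    rw [← hFG _ this.1, ← hFG _ this.2]
  have hd : deriv F =ᵐ[muI] g := by
    rw [Filter.EventuallyEq, ae_restrict_iff' measurableSet_Ioo]
    filter_upwards [hint.ae_hasDerivAt_integral] with x hx hxI
    have hx' : x ∈ uIcc (-1 : ℝ) 1 := by
      rw [uIcc_of_le (by norm_num)]
      exact Ioo_subset_Icc_self hxI
    have h1 := (hx hx' (-1) (by simp)).deriv
    rw [← h1]
    refine Filter.EventuallyEq.deriv_eq ?_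
    filter_upwards [isOpen_Ioo.mem_nhds hxI] with y hy
    simp only [hF, if_pos hy, hG]
  exact ⟨⟨F, hFac, hg.ae_eq hd.symm, fun x hx => if_neg hx⟩, hd⟩

/-- Derivatives of elements of `H10` are exactly the square integrable functions of mean zero. An
orthogonal complement is closed, hence complete, and completeness passes back along the isometry. -/
theorem range_toL2 : range toL2 =
    ((ℝ ∙ ((memLp_const (1 : ℝ) : MemLp (fun _ : ℝ => (1 : ℝ)) 2 muI).toLp _))ᗮ :
      Submodule ℝ (Lp ℝ 2 muI)) := by
  have key : ∀ g : Lp ℝ 2 muI, inner ℝ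
      ((memLp_const (1 : ℝ) : MemLp (fun _ : ℝ => (1 : ℝ)) 2 muI).toLp _) g = ∫ x, g x ∂muI := by
    intro g
    rw [L2.inner_def]
    refine integral_congr_ae ?_
    filter_upwards [(memLp_const (1 : ℝ) : MemLp (fun _ : ℝ => (1 : ℝ)) 2 muI).coeFn_toLp] with x hx
    rw [hx]
    simp
  ext g
  rw [SetLike.mem_coe, Submodule.mem_orthogonal_singleton_iff_inner_right, key]
  constructor
  · rintro ⟨v, rfl⟩
    exact (integral_congr_ae v.memLp_D.coeFn_toLp).trans v.integral_D
  · intro h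
    obtain ⟨v, hv⟩ := exists_D_ae_eq (Lp.memLp g) h
    refine ⟨v, ?_⟩
    refine Lp.ext ?_
    exact v.memLp_D.coeFn_toLp.trans hv

instance : CompleteSpace H10 := by
  rw [completeSpace_iff_isComplete_range toL2.isometry.isUniformInducing, range_toL2]
  exact (Submodule.isClosed_orthogonal _).isComplete

end H10

/-! ### Completeness of the basis -/

theorem integrable_D_mul_of_continuous (v : H10) {g : ℝ → ℝ} (hg : Continuous g) :
    Integrable (fun x => v.D x * g x) muI := by
  obtain ⟨M, hM⟩ := (isCompact_Icc (a := (-1 : ℝ)) (b := 1)).exists_bound_of_continuousOn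
    hg.continuousOn
  refine (v.memLp_D.integrable (by norm_num)).mul_bdd (c := M) hg.aestronglyMeasurable ?_
  rw [ae_restrict_iff' measurableSet_Ioo]
  exact Filter.Eventually.of_forall fun x hx => hM x (Ioo_subset_Icc_self hx)

/-- The Legendre polynomials, as a sequence of polynomials of increasing degree. -/
def legendreSequence : Polynomial.Sequence ℝ := ⟨legendre, degree_legendre⟩

/-- Legendre polynomials of degree `n ≥ 1` are reached through `η_{n+1}`. The remaining degree `0`
is covered by the zero boundary values, which give `Dv` mean zero. -/
theorem integral_D_mul_polynomial {v : H10} (hv : ∀ k, inner ℝ v (eta k) = 0) (p : ℝ[X]) :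
    ∫ x, v.D x * p.eval x ∂muI = 0 := by
  have hspan : p ∈ Submodule.span ℝ (range legendreSequence) := by
    rw [legendreSequence.span fun i =>
      (isUnit_iff_ne_zero.2 (leadingCoeff_ne_zero.2 (legendreSequence.ne_zero i)))]
    trivial
  induction hspan using Submodule.span_induction with
  | mem q hq =>
    obtain ⟨n, rfl⟩ := hq
    change ∫ x, v.D x * (legendre n).eval x ∂muI = 0
    rcases Nat.eq_zero_or_pos n with rfl | hn
    · have : legendre 0 = 1 := by simp [legendre]
      simp only [this, eval_one, mul_one]
      exact v.integral_D
    · have h := hv ⟨n + 1, by omega⟩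
      rw [inner_eta] at h
      refine (mul_eq_zero.1 h).resolve_left ?_
      have : (1 : ℝ) ≤ n := by exact_mod_cast hn
      rw [← Ne, neg_ne_zero, Real.sqrt_ne_zero']
      push_cast
      linarith
  | zero => simp
  | add p q _ _ hp hq =>
    simp only [eval_add, mul_add]
    rw [integral_add (integrable_D_mul_of_continuous v p.continuous)
      (integrable_D_mul_of_continuous v q.continuous), hp, hq, add_zero]
  | smul c p _ hp =>
    simp only [eval_smul, smul_eq_mul, mul_left_comm _ c]
    rw [integral_const_mul, hp, mul_zero]

theorem integral_D_mul_continuous {v : H10} (hv : ∀ k, inner ℝ v (eta k) = 0) {g : ℝ → ℝ}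
    (hg : Continuous g) : ∫ x, v.D x * g x ∂muI = 0 := by
  have hi : Integrable (fun x => ‖v.D x‖) muI := (v.memLp_D.integrable (by norm_num)).norm
  refine eq_of_abs_sub_le_all fun ε hε => ?_
  have hB : 0 < (∫ x, ‖v.D x‖ ∂muI) + 1 := by
    have : 0 ≤ ∫ x, ‖v.D x‖ ∂muI := integral_nonneg fun x => norm_nonneg _
    linarith
  -- Weierstrass approximation; the added `1` keeps the denominator positive when `Dv` vanishes.
  obtain ⟨p, hp⟩ := exists_polynomial_near_of_continuousOn (-1) 1 g hg.continuousOn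
    (ε / ((∫ x, ‖v.D x‖ ∂muI) + 1)) (by positivity)
  rw [sub_zero, ← sub_zero (∫ x, v.D x * g x ∂muI), ← integral_D_mul_polynomial hv p,
    ← integral_sub (integrable_D_mul_of_continuous v hg)
      (integrable_D_mul_of_continuous v p.continuous), ← Real.norm_eq_abs]
  calc ‖∫ x, (v.D x * g x - v.D x * p.eval x) ∂muI‖
      ≤ ∫ x, ‖v.D x‖ * (ε / ((∫ x, ‖v.D x‖ ∂muI) + 1)) ∂muI := by
        refine norm_integral_le_of_norm_le (hi.mul_const _) ?_
        rw [ae_restrict_iff' measurableSet_Ioo]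
        refine Filter.Eventually.of_forall fun x hx => ?_
        rw [← mul_sub, norm_mul, Real.norm_eq_abs (g x - _), abs_sub_comm]
        exact mul_le_mul_of_nonneg_left (hp x (Ioo_subset_Icc_self hx)).le (norm_nonneg _)
    _ = (∫ x, ‖v.D x‖ ∂muI) / ((∫ x, ‖v.D x‖ ∂muI) + 1) * ε := by
        rw [integral_mul_const]
        ring
    _ ≤ 1 * ε := by
        refine mul_le_mul_of_nonneg_right ?_ hε.le
        rw [div_le_one hB]
        linarith
    _ = ε := one_mul ε

theorem eq_zero_of_inner_eta {v : H10} (hv : ∀ k, inner ℝ v (eta k) = 0) : v = 0 := by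
  have hloc : LocallyIntegrableOn v.D (Ioo (-1 : ℝ) 1) volume := by
    have : IntegrableOn v.D (Ioo (-1 : ℝ) 1) volume := v.memLp_D.integrable (by norm_num)
    exact this.locallyIntegrableOn
  have h := isOpen_Ioo.ae_eq_zero_of_integral_contDiff_smul_eq_zero hloc fun g hg _ hs => by
    rw [← integral_D_mul_continuous hv hg.continuous]
    rw [← setIntegral_eq_integral_of_forall_compl_eq_zero (s := Ioo (-1 : ℝ) 1)]
    · simp only [smul_eq_mul, mul_comm]
    · intro x hx
      rw [image_eq_zero_of_notMem_tsupport (fun h => hx (hs h)), zero_smul]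
  rw [← norm_eq_zero, ← sq_eq_zero_iff, H10.norm_sq]
  refine integral_eq_zero_of_ae ?_
  rw [Filter.EventuallyEq, ae_restrict_iff' measurableSet_Ioo]
  filter_upwards [h] with x hx hxI
  simp [hx hxI]

/-- The Babuška–Shen basis as a Hilbert basis of `H¹₀(-1,1)`. -/
def etaBasis : HilbertBasis N2 ℝ H10 :=
  HilbertBasis.mkOfOrthogonalEqBot orthonormal_eta <| by
    rw [Submodule.eq_bot_iff]
    intro v hv
    refine eq_zero_of_inner_eta fun k => ?_
    rw [Submodule.mem_orthogonal'] at hv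
    exact hv _ (Submodule.subset_span (mem_range_self k))

@[simp]
theorem etaBasis_apply (k : N2) : etaBasis k = eta k := by
  simp [etaBasis]

/-! ### Coefficients and projections -/

theorem coeff_eq_repr (v : H10) (k : N2) : coeff v k = etaBasis.repr v k := by
  rw [etaBasis.repr_apply_apply, etaBasis_apply, coeff, real_inner_comm]

theorem coeff_add (v w : H10) (k : N2) : coeff (v + w) k = coeff v k + coeff w k :=
  inner_add_left _ _ _

theorem coeff_sub (v w : H10) (k : N2) : coeff (v - w) k = coeff v k - coeff w k :=
  inner_sub_left _ _ _

theorem coeff_smul (c : ℝ) (v : H10) (k : N2) : coeff (c • v) k = c * coeff v k :=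
  real_inner_smul_left _ _ _

theorem coeff_sum {ι : Type*} (S : Finset ι) (v : ι → H10) (k : N2) :
    coeff (∑ i ∈ S, v i) k = ∑ i ∈ S, coeff (v i) k :=
  sum_inner _ _ _

theorem coeff_eta (j k : N2) : coeff (eta j) k = if j = k then 1 else 0 :=
  orthonormal_iff_ite.1 orthonormal_eta j k

theorem coeff_sum_smul_eta (S : Finset N2) (c : N2 → ℝ) (k : N2) :
    coeff (∑ j ∈ S, c j • eta j) k = if k ∈ S then c k else 0 := by
  simp [coeff_sum, coeff_smul, coeff_eta]

theorem coeff_proj (S : Finset N2) (v : H10) (k : N2) :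
    coeff (proj S v) k = if k ∈ S then coeff v k else 0 :=
  coeff_sum_smul_eta S (coeff v) k

theorem ext_coeff {v w : H10} (h : ∀ k, coeff v k = coeff w k) : v = w := by
  rw [← sub_eq_zero]
  refine eq_zero_of_inner_eta fun k => ?_
  have := coeff_sub v w k
  rw [h, sub_self] at this
  exact this

theorem hasSum_coeff_mul (v w : H10) : HasSum (fun k => coeff v k * coeff w k) (inner ℝ v w) := by
  have := etaBasis.hasSum_inner_mul_inner v w
  simp only [etaBasis_apply] at this
  simpa only [coeff, real_inner_comm] using this

theorem hasSum_coeff_sq (v : H10) : HasSum (fun k => coeff v k ^ 2) (‖v‖ ^ 2) := by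
  have := hasSum_coeff_mul v v
  rw [real_inner_self_eq_norm_sq] at this
  simpa only [sq] using this

theorem abs_coeff_le (v : H10) (k : N2) : |coeff v k| ≤ ‖v‖ := by
  have := abs_real_inner_le_norm v (eta k)
  rwa [orthonormal_eta.1 k, mul_one] at this

theorem norm_sum_smul_eta_sq (S : Finset N2) (c : N2 → ℝ) :
    ‖∑ j ∈ S, c j • eta j‖ ^ 2 = ∑ j ∈ S, c j ^ 2 := by
  refine (hasSum_coeff_sq _).unique ?_
  have h : HasSum (fun k => coeff (∑ j ∈ S, c j • eta j) k ^ 2)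
      (∑ k ∈ S, coeff (∑ j ∈ S, c j • eta j) k ^ 2) :=
    hasSum_sum_of_ne_finset_zero fun k hk => by simp only [coeff_sum_smul_eta, if_neg hk]; ring
  convert! h using 1
  exact Finset.sum_congr rfl fun k hk => by rw [coeff_sum_smul_eta, if_pos hk]

theorem norm_proj_sq (S : Finset N2) (v : H10) : ‖proj S v‖ ^ 2 = ∑ k ∈ S, coeff v k ^ 2 :=
  norm_sum_smul_eta_sq S (coeff v)

theorem norm_sub_proj_sq (S : Finset N2) (v : H10) :
    ‖v - proj S v‖ ^ 2 = ‖v‖ ^ 2 - ‖proj S v‖ ^ 2 := by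
  have h : inner ℝ v (proj S v) = ‖proj S v‖ ^ 2 := by
    rw [norm_proj_sq, proj, inner_sum]
    refine Finset.sum_congr rfl fun k _ => ?_
    rw [real_inner_smul_right, sq]
    rfl
  rw [norm_sub_sq_real, h]
  ring

theorem norm_sub_proj_anti {S T : Finset N2} (h : S ⊆ T) (v : H10) :
    ‖v - proj T v‖ ≤ ‖v - proj S v‖ := by
  rw [← sq_le_sq₀ (norm_nonneg _) (norm_nonneg _), norm_sub_proj_sq, norm_sub_proj_sq,
    norm_proj_sq, norm_proj_sq]
  have := Finset.sum_le_sum_of_subset_of_nonneg h fun k _ _ => sq_nonneg (coeff v k)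
  linarith

@[simp]
theorem proj_empty (v : H10) : proj ∅ v = 0 := by simp [proj]

theorem norm_sub_proj_le (S : Finset N2) (v : H10) : ‖v - proj S v‖ ≤ ‖v‖ := by
  simpa using norm_sub_proj_anti (Finset.empty_subset S) v

theorem norm_proj_le (S : Finset N2) (v : H10) : ‖proj S v‖ ≤ ‖v‖ := by
  rw [← sq_le_sq₀ (norm_nonneg _) (norm_nonneg _)]
  have h := norm_sub_proj_sq S v
  have := sq_nonneg ‖v - proj S v‖
  linarith

theorem proj_add (S : Finset N2) (v w : H10) : proj S (v + w) = proj S v + proj S w := by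
  refine ext_coeff fun k => ?_
  simp only [coeff_proj, coeff_add]
  split_ifs <;> simp

theorem norm_sub_proj_add_le (S : Finset N2) (v w : H10) :
    ‖(v + w) - proj S (v + w)‖ ≤ ‖v - proj S v‖ + ‖w - proj S w‖ := by
  rw [proj_add, add_sub_add_comm]
  exact norm_add_le _ _

theorem sum_smul_eta_mem_VLam (S : Finset N2) (c : N2 → ℝ) : ∑ j ∈ S, c j • eta j ∈ VLam S :=
  Submodule.sum_mem _ fun _ hj => Submodule.smul_mem _ _
    (Submodule.subset_span (mem_image_of_mem _ hj))

theorem proj_mem_VLam (S : Finset N2) (v : H10) : proj S v ∈ VLam S :=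
  sum_smul_eta_mem_VLam S (coeff v)

theorem mem_VLam_iff {S : Finset N2} {v : H10} : v ∈ VLam S ↔ ∀ k, k ∉ S → coeff v k = 0 := by
  constructor
  · intro hv k hk
    induction hv using Submodule.span_induction with
    | mem x hx =>
      obtain ⟨j, hj, rfl⟩ := hx
      rw [coeff_eta, if_neg]
      rintro rfl
      exact hk hj
    | zero => exact inner_zero_left _
    | add x y _ _ hx hy => rw [coeff_add, hx, hy, add_zero]
    | smul c x _ hx => rw [coeff_smul, hx, mul_zero]
  · intro h
    have : v = proj S v := by
      refine ext_coeff fun k => ?_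
      rw [coeff_proj]
      split_ifs with hk
      · rfl
      · exact h k hk
    rw [this]
    exact proj_mem_VLam S v

theorem proj_eq_self {S : Finset N2} {v : H10} (hv : v ∈ VLam S) : proj S v = v := by
  refine ext_coeff fun k => ?_
  rw [coeff_proj]
  split_ifs with hk
  · rfl
  · exact (mem_VLam_iff.1 hv k hk).symm

theorem VLam_mono {S T : Finset N2} (h : S ⊆ T) : VLam S ≤ VLam T := fun _ hv =>
  mem_VLam_iff.2 fun k hk => mem_VLam_iff.1 hv k fun hk' => hk (h hk')

/-! ### The Riesz representative of a functional -/

/-- The Riesz representative of `f ∈ H⁻¹` in `H¹₀`. -/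
def riesz (f : Hm1) : H10 := (InnerProductSpace.toDual ℝ H10).symm f

theorem inner_riesz (f : Hm1) (v : H10) : inner ℝ (riesz f) v = f v :=
  InnerProductSpace.toDual_symm_apply

theorem norm_riesz (f : Hm1) : ‖riesz f‖ = ‖f‖ := LinearIsometryEquiv.norm_map _ _

theorem coeff_riesz (f : Hm1) (k : N2) : coeff (riesz f) k = f (eta k) := inner_riesz f _

theorem riesz_sub (f g : Hm1) : riesz (f - g) = riesz f - riesz g := map_sub _ _ _

theorem riesz_add (f g : Hm1) : riesz (f + g) = riesz f + riesz g := map_add _ _ _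

/-- The Riesz map is an isometry exchanging the two projections, so errors in `Hm1` become errors in
`H10`. -/
theorem riesz_projDual (S : Finset N2) (f : Hm1) : riesz (projDual S f) = proj S (riesz f) := by
  refine ext_coeff fun k => ?_
  rw [coeff_riesz, coeff_proj, coeff_riesz, projDual, _root_.sum_apply]
  simp [etaDual_apply, coeff_eta]

theorem norm_projDual (S : Finset N2) (f : Hm1) : ‖projDual S f‖ = ‖proj S (riesz f)‖ := by
  rw [← norm_riesz, riesz_projDual]

theorem norm_sub_projDual (S : Finset N2) (f : Hm1) :
    ‖f - projDual S f‖ = ‖riesz f - proj S (riesz f)‖ := by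
  rw [← norm_riesz, riesz_sub, riesz_projDual]

theorem bestErrDual_eq (f : Hm1) : bestErrDual f = bestErr (riesz f) := by
  funext N
  simp only [bestErrDual, bestErr, norm_sub_projDual]

/-! ### Best approximation errors -/

theorem bddBelow_range_norm_sub_proj (v : H10) (N : ℕ) :
    BddBelow (range fun S : {S : Finset N2 // S.card = N} => ‖v - proj S.1 v‖) :=
  ⟨0, by rintro _ ⟨S, rfl⟩; exact norm_nonneg _⟩

instance : Infinite N2 :=
  Infinite.of_injective (fun n : ℕ => (⟨n + 2, by omega⟩ : N2)) fun a b h => by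
    simpa using congrArg Subtype.val h

instance (N : ℕ) : Nonempty {S : Finset N2 // S.card = N} :=
  let ⟨S, hS⟩ := Infinite.exists_subset_card_eq N2 N
  ⟨⟨S, hS⟩⟩

theorem bestErr_nonneg (v : H10) (N : ℕ) : 0 ≤ bestErr v N :=
  Real.iInf_nonneg fun _ => norm_nonneg _

/-- Smaller sets may be padded to exactly `N` indices, since `N2` is infinite and enlarging a set
never increases the error. -/
theorem bestErr_le {S : Finset N2} {N : ℕ} (hS : S.card ≤ N) (v : H10) :
    bestErr v N ≤ ‖v - proj S v‖ := by
  obtain ⟨T, hST, hT⟩ := Infinite.exists_superset_card_eq S N hS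
  exact (ciInf_le (bddBelow_range_norm_sub_proj v N) ⟨T, hT⟩).trans (norm_sub_proj_anti hST v)

theorem exists_norm_sub_proj_lt {v : H10} {N : ℕ} {ε : ℝ} (h : bestErr v N < ε) :
    ∃ S : Finset N2, S.card = N ∧ ‖v - proj S v‖ < ε := by
  obtain ⟨S, hS⟩ := exists_lt_of_ciInf_lt h
  exact ⟨S.1, S.2, hS⟩

theorem bestErr_zero (v : H10) : bestErr v 0 = ‖v‖ := by
  refine le_antisymm (by simpa using bestErr_le (S := ∅) le_rfl v) ?_
  refine le_ciInf fun S => ?_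
  rw [Finset.card_eq_zero.1 S.2, proj_empty, sub_zero]

theorem bestErr_le_classNorm {v : H10} {η t : ℝ} (h : InClass (bestErr v) η t) (N : ℕ) :
    bestErr v N ≤ classNorm (bestErr v) η t * Real.exp (-(η * (N : ℝ) ^ t)) := by
  have := le_ciSup h N
  rw [Real.exp_neg, ← div_eq_mul_inv, le_div_iff₀ (Real.exp_pos _)]
  exact this

/-- This is the term `N = 0` of the supremum, where positivity of `t` gives `0 ^ t = 0`. -/
theorem norm_le_classNorm {v : H10} {η t : ℝ} (ht : 0 < t) (h : InClass (bestErr v) η t) :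
    ‖v‖ ≤ classNorm (bestErr v) η t := by
  have := bestErr_le_classNorm h 0
  rwa [bestErr_zero, Nat.cast_zero, Real.zero_rpow ht.ne', mul_zero, neg_zero, Real.exp_zero,
    mul_one] at this

theorem inClass_of_forall_le {E : ℕ → ℝ} {η t K : ℝ}
    (h : ∀ N : ℕ, E N ≤ K * Real.exp (-(η * (N : ℝ) ^ t))) :
    InClass E η t ∧ classNorm E η t ≤ K := by
  have h' : ∀ N : ℕ, E N * Real.exp (η * (N : ℝ) ^ t) ≤ K := by
    intro N
    have := h N
    rwa [Real.exp_neg, ← div_eq_mul_inv, le_div_iff₀ (Real.exp_pos _)] at this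
  exact ⟨⟨K, by rintro _ ⟨N, rfl⟩; exact h' N⟩, ciSup_le h'⟩

theorem le_mul_ceil_rpow {η t X : ℝ} (hη : 0 < η) (ht : 0 < t) (hX : 0 ≤ X) :
    X ≤ η * (⌈(X / η) ^ (1 / t)⌉₊ : ℝ) ^ t := by
  have h0 : 0 ≤ X / η := by positivity
  have h1 : X / η ≤ (⌈(X / η) ^ (1 / t)⌉₊ : ℝ) ^ t := by
    calc X / η = ((X / η) ^ (1 / t)) ^ t := by
          rw [← Real.rpow_mul h0, one_div_mul_cancel ht.ne', Real.rpow_one]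
      _ ≤ _ := Real.rpow_le_rpow (by positivity) (Nat.le_ceil _) ht.le
  rw [div_le_iff₀ hη] at h1
  linarith

/-- A sparse index set that reaches a given accuracy for an element of a sparsity class. -/
theorem exists_card_le_of_inClass {v : H10} {η t : ℝ} (hη : 0 < η) (ht : 0 < t)
    (h : InClass (bestErr v) η t) {ε X : ℝ} (hε : 0 < ε) (hX : 0 ≤ X)
    (hle : 2 * classNorm (bestErr v) η t ≤ ε * Real.exp X) :
    ∃ S : Finset N2, ‖v - proj S v‖ ≤ ε ∧ (S.card : ℝ) ≤ 1 / η ^ (1 / t) * X ^ (1 / t) + 1 := by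
  have hN := le_mul_ceil_rpow hη ht hX
  set N := ⌈(X / η) ^ (1 / t)⌉₊ with hNdef
  -- The factor `2` in the assumption makes this strict, so a set of error below `ε` exists without
  -- knowing that the infimum is attained.
  have hlt : bestErr v N < ε := by
    refine (bestErr_le_classNorm h N).trans_lt ?_
    have h0 : 0 ≤ classNorm (bestErr v) η t := (norm_nonneg v).trans (norm_le_classNorm ht h)
    calc classNorm (bestErr v) η t * Real.exp (-(η * (N : ℝ) ^ t))
        ≤ classNorm (bestErr v) η t * Real.exp (-X) := by gcongr
      _ ≤ ε / 2 := by
          rw [Real.exp_neg, ← div_eq_mul_inv, div_le_iff₀ (Real.exp_pos _)]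
          linarith
      _ < ε := half_lt_self hε
  obtain ⟨S, hS, hlt⟩ := exists_norm_sub_proj_lt hlt
  refine ⟨S, hlt.le, ?_⟩
  rw [hS, one_div_mul_eq_div, ← Real.div_rpow hX hη.le]
  exact (Nat.ceil_lt_add_one (by positivity)).le

/-! ### Coercivity, continuity and Galerkin approximation -/

namespace H10

/-- The factor `2` matters. The cruder `abs_apply_le` would replace the continuity constant `5 α^*`
below by `9 α^*` and the predictor factor `1 + √5` by `4`, leaving no room under the coarsening
tolerance. -/
theorem sq_apply_le (v : H10) (x : ℝ) : v x ^ 2 ≤ 2 * ‖v‖ ^ 2 := by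
  by_cases hx : x ∈ Ioo (-1 : ℝ) 1
  · have h1 : MemLp (fun _ : ℝ => (1 : ℝ)) 2 muI := memLp_const 1
    have h2 := integral_mul_norm_le_Lp_mul_Lq (μ := muI) (f := v.D) (g := fun _ => (1 : ℝ))
      Real.HolderConjugate.two_two (by simpa using v.memLp_D) (by simpa using h1)
    have h3 : (∫ _ : ℝ, ‖(1 : ℝ)‖ ^ (2 : ℝ) ∂muI) = 2 := by
      simp [Measure.real]
      norm_num
    rw [← norm_eq, h3, ← Real.sqrt_eq_rpow] at h2
    have hint : Integrable v.D muI := v.memLp_D.integrable (by norm_num)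
    have h4 : |v x| ≤ ‖v‖ * √2 := by
      rw [eq_integral_D v (Ioo_subset_Icc_self hx), intervalIntegral.integral_of_le hx.1.le]
      calc |∫ s in Ioc (-1 : ℝ) x, v.D s| ≤ ∫ s in Ioc (-1 : ℝ) x, ‖v.D s‖ := by
            rw [← Real.norm_eq_abs]
            exact norm_integral_le_integral_norm _
        _ ≤ ∫ s, ‖v.D s‖ ∂muI := by
            refine setIntegral_mono_set hint.norm
              (Filter.Eventually.of_forall fun s => norm_nonneg _) ?_
            exact Filter.Eventually.of_forall fun s hs => ⟨hs.1, lt_of_le_of_lt hs.2 hx.2⟩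
        _ = ∫ s, ‖v.D s‖ * ‖(1 : ℝ)‖ ∂muI := by simp
        _ ≤ _ := h2
    calc v x ^ 2 = |v x| ^ 2 := (sq_abs _).symm
      _ ≤ (‖v‖ * √2) ^ 2 := by gcongr
      _ = 2 * ‖v‖ ^ 2 := by rw [mul_pow, Real.sq_sqrt (by norm_num)]; ring
  · have : v x = 0 := v.2.2.2 x hx
    rw [this, sq, zero_mul]
    positivity

end H10

namespace EllipticData

variable (P : EllipticData)

theorem alphaLo_pos : 0 < P.alphaLo := P.nuLo_pos

theorem alphaHi_pos : 0 < P.alphaHi :=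
  lt_max_of_lt_left (P.nuLo_pos.trans_le
    ((P.nuLo_le 0 (by norm_num)).trans (P.le_nuHi 0 (by norm_num))))

theorem alphaLo_mul_norm_sq_le (v : H10) : P.alphaLo * ‖v‖ ^ 2 ≤ P.form v v := by
  have h1 : P.alphaLo * ‖v‖ ^ 2 ≤ ∫ x, P.ν x * (v.D x * v.D x) ∂muI := by
    rw [H10.norm_sq, ← integral_const_mul]
    refine setIntegral_mono_on ((v.integrable_D_mul_D v).const_mul _) (P.integrable_nu v v)
      measurableSet_Ioo fun x hx => ?_
    exact mul_le_mul_of_nonneg_right (P.nuLo_le x hx) (mul_self_nonneg _)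
  have h2 : 0 ≤ ∫ x, P.σ x * (v x * v x) ∂muI :=
    setIntegral_nonneg measurableSet_Ioo fun x hx =>
      mul_nonneg (P.sigma_nonneg x hx) (mul_self_nonneg _)
  rw [form]
  linarith

theorem form_self_nonneg (v : H10) : 0 ≤ P.form v v :=
  (mul_nonneg P.alphaLo_pos.le (sq_nonneg _)).trans (P.alphaLo_mul_norm_sq_le v)

/-- The constant is `5 = 1 + 2 · 2`: one for the diffusion term, and the pointwise bound times the
length of the interval for the reaction term. -/
theorem form_self_le (v : H10) : P.form v v ≤ 5 * P.alphaHi * ‖v‖ ^ 2 := by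
  have h1 : ∫ x, P.ν x * (v.D x * v.D x) ∂muI ≤ P.alphaHi * ‖v‖ ^ 2 := by
    rw [H10.norm_sq, ← integral_const_mul]
    refine setIntegral_mono_on (P.integrable_nu v v) ((v.integrable_D_mul_D v).const_mul _)
      measurableSet_Ioo fun x hx => ?_
    exact mul_le_mul_of_nonneg_right ((P.le_nuHi x hx).trans (le_max_left _ _))
      (mul_self_nonneg _)
  have h2 : ∫ x, P.σ x * (v x * v x) ∂muI ≤ 4 * (P.alphaHi * ‖v‖ ^ 2) := by
    calc ∫ x, P.σ x * (v x * v x) ∂muI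
        ≤ ∫ _, P.alphaHi * (2 * ‖v‖ ^ 2) ∂muI := by
          refine setIntegral_mono_on (P.integrable_sigma v v) (integrable_const _)
            measurableSet_Ioo fun x hx => ?_
          refine mul_le_mul ((P.le_sigHi x hx).trans (le_max_right _ _)) ?_ (mul_self_nonneg _)
            P.alphaHi_pos.le
          rw [← sq]
          exact v.sq_apply_le x
      _ = _ := by
          rw [integral_const]
          have hv : muI.real univ = 2 := by
            simp [Measure.real]
            norm_num
          rw [hv, smul_eq_mul]
          ring
  rw [form]
  linarith

theorem form_sub_left (v w z : H10) : P.form (v - w) z = P.form v z - P.form w z := by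
  rw [sub_eq_add_neg, P.form_add_left, ← neg_one_smul ℝ w, P.form_smul_left]
  ring

theorem form_add_right (v w z : H10) : P.form v (w + z) = P.form v w + P.form v z := by
  rw [P.form_comm, P.form_add_left, P.form_comm w, P.form_comm z]

theorem form_smul_right (c : ℝ) (v w : H10) : P.form v (c • w) = c * P.form v w := by
  rw [P.form_comm, P.form_smul_left, P.form_comm w]

/-- The Cauchy–Schwarz inequality for the energy inner product. -/
theorem form_le_sqrt_mul_sqrt (v w : H10) :
    P.form v w ≤ √(P.form v v) * √(P.form w w) := by
  rw [← Real.sqrt_mul (P.form_self_nonneg v)]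
  refine Real.le_sqrt_of_sq_le ?_
  -- A quadratic in `s` that is nowhere negative has nonpositive discriminant.
  have h : ∀ s : ℝ, 0 ≤ P.form w w * (s * s) + 2 * P.form v w * s + P.form v v := by
    intro s
    have := P.form_self_nonneg (v + s • w)
    rw [form_add_left, form_add_right, form_add_right, form_smul_left, form_smul_left,
      form_smul_right, form_smul_right, P.form_comm w v] at this
    linarith
  have := discrim_le_zero h
  rw [discrim] at this
  linarith

theorem sqrt_alphaLo_mul_norm_le (v : H10) : √P.alphaLo * ‖v‖ ≤ √(P.form v v) := by
  rw [← Real.sqrt_sq (norm_nonneg v), ← Real.sqrt_mul P.alphaLo_pos.le]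
  exact Real.sqrt_le_sqrt (P.alphaLo_mul_norm_sq_le v)

theorem sqrt_form_le (v : H10) : √(P.form v v) ≤ √(5 * P.alphaHi) * ‖v‖ := by
  have h : 0 ≤ 5 * P.alphaHi := by linarith [P.alphaHi_pos]
  rw [← Real.sqrt_sq (norm_nonneg v), ← Real.sqrt_mul h]
  exact Real.sqrt_le_sqrt (P.form_self_le v)

variable {P}

theorem IsGalerkin.form_sub_eq_zero {f : Hm1} {u w : H10} {S : Finset N2}
    (hw : P.IsGalerkin f S w) (hu : P.IsSolution f u) {z : H10} (hz : z ∈ VLam S) :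
    P.form (u - w) z = 0 := by
  rw [form_sub_left, hu z, hw.2 z hz, sub_self]

/-- Galerkin solutions are best approximations in the energy norm. -/
theorem IsGalerkin.sqrt_form_sub_le {f : Hm1} {u w : H10} {S : Finset N2}
    (hw : P.IsGalerkin f S w) (hu : P.IsSolution f u) {z : H10} (hz : z ∈ VLam S) :
    √(P.form (u - w) (u - w)) ≤ √(P.form (u - z) (u - z)) := by
  have h : P.form (u - w) (u - w) = P.form (u - w) (u - z) := by
    have := hw.form_sub_eq_zero hu (Submodule.sub_mem _ hw.1 hz)
    rw [show u - z = (u - w) + (w - z) by abel, form_add_right, this, add_zero]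
  have h2 := P.form_le_sqrt_mul_sqrt (u - w) (u - z)
  rw [← h] at h2
  nth_rewrite 1 [← Real.mul_self_sqrt (P.form_self_nonneg (u - w))] at h2
  rcases (Real.sqrt_nonneg (P.form (u - w) (u - w))).eq_or_lt with h0 | h0
  · rw [← h0]
    exact Real.sqrt_nonneg _
  · exact le_of_mul_le_mul_left h2 h0

variable (P) in
/-- The quasi-optimality constant of Galerkin approximations. -/
def quasiOpt : ℝ := √(5 * P.alphaHi) / √P.alphaLo

variable (P) in
theorem quasiOpt_pos : 0 < P.quasiOpt :=
  div_pos (Real.sqrt_pos.2 (by linarith [P.alphaHi_pos])) (Real.sqrt_pos.2 P.alphaLo_pos)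

/-- Céa's lemma. -/
theorem IsGalerkin.norm_sub_le {f : Hm1} {u w : H10} {S : Finset N2}
    (hw : P.IsGalerkin f S w) (hu : P.IsSolution f u) {z : H10} (hz : z ∈ VLam S) :
    ‖u - w‖ ≤ P.quasiOpt * ‖u - z‖ := by
  rw [quasiOpt, div_mul_eq_mul_div, le_div_iff₀ (Real.sqrt_pos.2 P.alphaLo_pos), mul_comm]
  exact (P.sqrt_alphaLo_mul_norm_le _).trans
    ((hw.sqrt_form_sub_le hu hz).trans (P.sqrt_form_le _))

theorem IsGalerkin.norm_sub_le_norm {f : Hm1} {u w : H10} {S : Finset N2}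
    (hw : P.IsGalerkin f S w) (hu : P.IsSolution f u) : ‖u - w‖ ≤ P.quasiOpt * ‖u‖ := by
  simpa using hw.norm_sub_le hu (Submodule.zero_mem _)

variable (P) in
theorem isGalerkin_empty (f : Hm1) : P.IsGalerkin f ∅ 0 := by
  refine ⟨Submodule.zero_mem _, fun v hv => ?_⟩
  have : v = 0 := by simpa [VLam] using hv
  rw [this, map_zero, ← zero_smul ℝ (0 : H10), form_smul_left, zero_mul]

theorem residual_apply {f : Hm1} {u : H10} (hu : P.IsSolution f u) (w z : H10) :
    P.residual f w z = P.form (u - w) z := by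
  rw [form_sub_left, hu z]
  rfl

end EllipticData

/-! ### The stiffness operator and its inverse in coordinates -/

theorem repr_symm_single (k : N2) :
    etaBasis.repr.symm (lp.single 2 k (1 : ℝ)) = eta k := by
  rw [HilbertBasis.repr_symm_single, etaBasis_apply]

theorem repr_sum_smul_eta (S : Finset N2) (c : N2 → ℝ) :
    etaBasis.repr (∑ k ∈ S, c k • eta k) = ∑ k ∈ S, c k • lp.single 2 k (1 : ℝ) := by
  simp only [map_sum, map_smul, ← repr_symm_single, LinearIsometryEquiv.apply_symm_apply]

theorem continuousLinearMap_ext_single {F : Type*} [NormedAddCommGroup F] [NormedSpace ℝ F]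
    {T U : Seq2 →L[ℝ] F}
    (h : ∀ k : N2, T (lp.single 2 k (1 : ℝ)) = U (lp.single 2 k (1 : ℝ))) : T = U := by
  refine lp.ext_continuousLinearMap (ENNReal.ofNat_ne_top (n := nat_lit 2)) fun i => ?_
  ext
  exact h i

/-- Both sides are continuous and linear in `y`, so unit sequences suffice. This identifies the
operator given by its matrix with `P.L` in coordinates. -/
theorem Represents.apply_repr {P : EllipticData} {T : Seq2 →L[ℝ] Seq2}
    (hT : Represents T P.stiffness) (y : Seq2) (m : N2) :
    T y m = P.form (etaBasis.repr.symm y) (eta m) := by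
  let Φ : Seq2 →L[ℝ] ℝ := (innerSL ℝ (lp.single 2 m (1 : ℝ) : Seq2)).comp T
  let Ψ : Seq2 →L[ℝ] ℝ := (P.L.flip (eta m)).comp
    (etaBasis.repr.symm.toContinuousLinearEquiv : Seq2 →L[ℝ] H10)
  have hΦ : ∀ z, Φ z = T z m := fun z => by
    simp [Φ, lp.inner_single_left]
  have hΨ : ∀ z, Ψ z = P.form (etaBasis.repr.symm z) (eta m) := fun z => rfl
  rw [← hΦ, ← hΨ]
  congr 1
  refine continuousLinearMap_ext_single fun k => ?_
  rw [hΦ, hΨ, hT m k, repr_symm_single]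
  rfl

theorem Represents.sub_trunc_apply {S TJ : Seq2 →L[ℝ] Seq2} {B : Matrix N2 N2 ℝ} {J : ℕ}
    (hS : Represents S B) (hTJ : Represents TJ (B - trunc J B)) (m k : N2) :
    (S - TJ) (lp.single 2 k (1 : ℝ)) m = trunc J B m k := by
  change S (lp.single 2 k (1 : ℝ)) m - TJ (lp.single 2 k (1 : ℝ)) m = _
  rw [hS m k, hTJ m k, Matrix.sub_apply]
  ring

/-- The banded part of the inverse moves an index by at most `J`, which is why enrichment by `J`
makes the approximate correction admissible. It is bounded as a difference of two bounded operators.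
-/
theorem Represents.sub_trunc_mem_VLam {S TJ : Seq2 →L[ℝ] Seq2} {B : Matrix N2 N2 ℝ} {J : ℕ}
    (hS : Represents S B) (hTJ : Represents TJ (B - trunc J B)) (Λ : Finset N2) (c : N2 → ℝ) :
    etaBasis.repr.symm ((S - TJ) (∑ k ∈ Λ, c k • lp.single 2 k (1 : ℝ))) ∈ VLam (enrich Λ J) := by
  simp only [map_sum, map_smul]
  refine Submodule.sum_mem _ fun k hk => Submodule.smul_mem _ _ ?_
  refine mem_VLam_iff.2 fun m hm => ?_
  rw [coeff_eq_repr, LinearIsometryEquiv.apply_symm_apply, hS.sub_trunc_apply hTJ, trunc, if_neg]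
  intro h
  exact hm ((mem_enrich Λ J m).2 ⟨k, hk, h⟩)

/-! ### The predictor and the corrector -/

/-- The defining set is nonempty because the exponential tends to `0` and the right-hand side is
positive for `θ < 1`; otherwise `sInf` would take its default value `0`. -/
theorem enrichRadius_spec (P : EllipticData) (C : ℝ) {γ θ : ℝ} (hγ : 0 < γ) (hθ : 0 < θ)
    (hθ1 : θ < 1) : 0 < enrichRadius P C γ θ ∧
      C * Real.exp (-γ * (enrichRadius P C γ θ : ℝ)) ≤
        √((1 - θ ^ 2) / (P.alphaLo * P.alphaHi)) := by
  refine Nat.sInf_mem (s := {J : ℕ | 0 < J ∧ C * Real.exp (-γ * (J : ℝ)) ≤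
    √((1 - θ ^ 2) / (P.alphaLo * P.alphaHi))}) ?_
  have hpos : 0 < √((1 - θ ^ 2) / (P.alphaLo * P.alphaHi)) :=
    Real.sqrt_pos.2 (div_pos (by nlinarith) (mul_pos P.alphaLo_pos P.alphaHi_pos))
  have hlim : Filter.Tendsto (fun J : ℕ => C * Real.exp (-γ * (J : ℝ))) Filter.atTop
      (nhds (C * 0)) := by
    refine Filter.Tendsto.const_mul C (Real.tendsto_exp_atBot.comp ?_)
    exact tendsto_natCast_atTop_atTop.const_mul_atTop_of_neg (neg_lt_zero.2 hγ)
  rw [mul_zero] at hlim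
  obtain ⟨J, hJ, hJ0⟩ := ((hlim.eventually_lt_const hpos).and
    (Filter.eventually_gt_atTop 0)).exists
  exact ⟨J, hJ0, hJ.le⟩

theorem norm_sub_projDual_le {r : Hm1} {θ : ℝ} {S : Finset N2} (hθ : 0 ≤ θ)
    (h : θ * ‖r‖ ≤ ‖projDual S r‖) : ‖r - projDual S r‖ ≤ √(1 - θ ^ 2) * ‖r‖ := by
  rw [norm_sub_projDual]
  rw [norm_projDual] at h
  rw [← norm_riesz] at h ⊢
  have h1 := norm_sub_proj_sq S (riesz r)
  have h2 : (θ * ‖riesz r‖) ^ 2 ≤ ‖proj S (riesz r)‖ ^ 2 :=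
    pow_le_pow_left₀ (by positivity) h 2
  rw [← Real.sqrt_sq (norm_nonneg (riesz r - _)), ← Real.sqrt_sq (norm_nonneg (riesz r)),
    ← Real.sqrt_mul' _ (sq_nonneg _)]
  refine Real.sqrt_le_sqrt ?_
  rw [h1]
  linarith

theorem sqrt_five_lt : √5 ≤ 9 / 4 := Real.sqrt_le_iff.2 ⟨by norm_num, by norm_num⟩

/-- The error of the predictor. -/
theorem predictor_error_le {P : EllipticData} {B : Matrix N2 N2 ℝ} {c θ : ℝ} {J : ℕ}
    (hB : IsInverse P.stiffness B) (htr : OpNormLe (B - trunc J B) c)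
    (hc : c ≤ √((1 - θ ^ 2) / (P.alphaLo * P.alphaHi))) (hθ : 0 ≤ θ) (hθ1 : θ ≤ 1)
    {f : Hm1} {u w what : H10} {Λ S : Finset N2} (hu : P.IsSolution f u) (hw : w ∈ VLam Λ)
    (hS : θ * ‖P.residual f w‖ ≤ ‖projDual S (P.residual f w)‖)
    (hwhat : P.IsGalerkin f (Λ ∪ enrich S J) what) :
    ‖u - what‖ ≤ 13 / 4 * (√(1 - θ ^ 2) * ‖P.residual f w‖ / P.alphaLo) := by
  obtain ⟨T, Sop, hT, hSop, hTS, -⟩ := hB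
  obtain ⟨TJ, hTJ, hTJc⟩ := htr
  set r := P.residual f w with hr
  set s := √(1 - θ ^ 2) with hs
  have hs2 : 0 ≤ 1 - θ ^ 2 := by nlinarith
  have hα := P.alphaLo_pos
  have hα' := P.alphaHi_pos
  set x : Seq2 := etaBasis.repr (proj S (riesz r)) with hx
  have hxsum : x = ∑ k ∈ S, coeff (riesz r) k • lp.single 2 k (1 : ℝ) :=
    repr_sum_smul_eta S _
  -- `L e1` is the marked part of the residual and `L e2` the discarded part; `z` is `e1` with the
  -- inverse matrix replaced by its band.
  set e1 : H10 := etaBasis.repr.symm (Sop x) with he1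
  set e2 : H10 := (u - w) - e1 with he2
  set z : H10 := etaBasis.repr.symm ((Sop - TJ) x) with hz
  have hzmem : w + z ∈ VLam (Λ ∪ enrich S J) := by
    refine Submodule.add_mem _ (VLam_mono Finset.subset_union_left hw)
      (VLam_mono Finset.subset_union_right ?_)
    rw [hz, hxsum]
    exact hSop.sub_trunc_mem_VLam hTJ S _
  -- the exact correction
  have hLe1 : ∀ v, P.form e1 v = inner ℝ (proj S (riesz r)) v := by
    have hE : P.L e1 = innerSL ℝ (proj S (riesz r)) := by
      have : riesz (P.L e1) = proj S (riesz r) := by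
        refine ext_coeff fun m => ?_
        rw [coeff_riesz, P.L_apply, ← hT.apply_repr, coeff_eq_repr, ← hx]
        have := congrArg (fun U : Seq2 →L[ℝ] Seq2 => U x m) hTS
        exact this
      rw [← this]
      ext v
      rw [innerSL_apply_apply, inner_riesz]
    intro v
    rw [← P.L_apply, hE, innerSL_apply_apply]
  have hLe2 : ∀ v, P.form e2 v = (r - projDual S r) v := by
    intro v
    rw [he2, P.form_sub_left, ← EllipticData.residual_apply hu, hLe1, ← riesz_projDual,
      inner_riesz]
    rfl
  have hrr := norm_sub_projDual_le hθ hS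
  have hdiff : ‖e1 - z‖ ≤ √((1 - θ ^ 2) / (P.alphaLo * P.alphaHi)) * ‖r‖ := by
    have : e1 - z = etaBasis.repr.symm (TJ x) := by
      rw [he1, hz, ← map_sub]
      congr 1
      change Sop x - (Sop x - TJ x) = TJ x
      abel
    rw [this, LinearIsometryEquiv.norm_map]
    have hxn : ‖x‖ ≤ ‖r‖ := by
      rw [hx, LinearIsometryEquiv.norm_map, ← norm_riesz]
      exact norm_proj_le S _
    calc ‖TJ x‖ ≤ ‖TJ‖ * ‖x‖ := TJ.le_opNorm x
      _ ≤ _ := mul_le_mul (hTJc.trans hc) hxn (norm_nonneg _) (Real.sqrt_nonneg _)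
  -- energy estimate
  set d := u - what with hd
  set E := √(P.form d d) with hE
  have hdE : √P.alphaLo * ‖d‖ ≤ E := P.sqrt_alphaLo_mul_norm_le d
  have hsα : 0 < √P.alphaLo := Real.sqrt_pos.2 hα
  -- Galerkin orthogonality removes the component of `d` in the predictor space. Working in the
  -- energy norm, rather than applying Céa's lemma, keeps the condition number out of the constant.
  have hform : P.form d d = P.form e2 d + P.form d (e1 - z) := by
    have h := hwhat.form_sub_eq_zero hu (Submodule.sub_mem _ hwhat.1 hzmem)
    have h' : d = (e2 + (e1 - z)) - (what - (w + z)) := by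
      rw [hd, he2]
      abel
    conv_lhs => rw [h', P.form_sub_left, P.form_add_left, ← h', P.form_comm (what - _), h,
      P.form_comm (e1 - z), sub_zero]
  have h2 : P.form e2 d ≤ s * ‖r‖ * (E / √P.alphaLo) := by
    rw [hLe2]
    have hd' : ‖d‖ ≤ E / √P.alphaLo := by
      rw [le_div_iff₀ hsα, mul_comm]
      exact hdE
    calc (r - projDual S r) d ≤ ‖(r - projDual S r) d‖ := le_abs_self _
      _ ≤ ‖r - projDual S r‖ * ‖d‖ := (r - projDual S r).le_opNorm d
      _ ≤ _ := mul_le_mul hrr hd' (norm_nonneg _) (by positivity)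
  -- The `α^*` in the definition of `J_θ` cancels the one in the continuity constant and leaves
  -- `√5`.
  have h3 : P.form d (e1 - z) ≤ E * (√5 * (s * ‖r‖ / √P.alphaLo)) := by
    refine (P.form_le_sqrt_mul_sqrt d (e1 - z)).trans ?_
    refine mul_le_mul_of_nonneg_left ?_ (Real.sqrt_nonneg _)
    refine (P.sqrt_form_le _).trans ((mul_le_mul_of_nonneg_left hdiff (Real.sqrt_nonneg _)).trans
      (le_of_eq ?_))
    rw [Real.sqrt_mul (by norm_num), Real.sqrt_div hs2, Real.sqrt_mul hα.le, ← hs]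
    have : √P.alphaHi ≠ 0 := (Real.sqrt_pos.2 hα').ne'
    field_simp
  have hE2 : E * E ≤ E * ((1 + √5) * (s * ‖r‖ / √P.alphaLo)) := by
    rw [hE, Real.mul_self_sqrt (P.form_self_nonneg d), ← hE, hform]
    refine (add_le_add h2 h3).trans (le_of_eq ?_)
    field_simp
  have hq : 0 ≤ s * ‖r‖ / √P.alphaLo := by positivity
  have hE3 : E ≤ 13 / 4 * (s * ‖r‖ / √P.alphaLo) := by
    have h5 : (1 + √5) * (s * ‖r‖ / √P.alphaLo) ≤ 13 / 4 * (s * ‖r‖ / √P.alphaLo) :=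
      mul_le_mul_of_nonneg_right (by linarith [sqrt_five_lt]) hq
    rcases (Real.sqrt_nonneg (P.form d d)).eq_or_lt with h0 | h0
    · rw [hE, ← h0]
      positivity
    · exact (le_of_mul_le_mul_left hE2 h0).trans h5
  have := hdE.trans hE3
  rw [mul_comm, ← le_div_iff₀ hsα] at this
  refine this.trans (le_of_eq ?_)
  conv_rhs => rw [← Real.mul_self_sqrt hα.le]
  field_simp

/-- The output of **COARSE** is at most as large as any set resolving the solution. -/
theorem IsCoarse.card_le {S₀ S Λ : Finset N2} {u what : H10} {ε a b : ℝ}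
    (h : IsCoarse S₀ what ε S) (hmem : what ∈ VLam S₀) (ha : ‖u - what‖ ≤ a)
    (hb : ‖u - proj Λ u‖ ≤ b) (hab : a + b ≤ 2 * ε) : S.card ≤ Λ.card := by
  classical
  -- Only subsets of `S₀` compete, but intersecting with `S₀` costs nothing since `what` has no
  -- coefficients outside it.
  refine (h.2.2 (Λ ∩ S₀) Finset.inter_subset_right ?_).trans
    (Finset.card_le_card Finset.inter_subset_left)
  have hp : proj (Λ ∩ S₀) what = proj Λ what := by
    refine ext_coeff fun k => ?_
    rw [coeff_proj, coeff_proj]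
    by_cases h0 : k ∈ S₀
    · simp [h0]
    · simp [mem_VLam_iff.1 hmem k h0]
  rw [hp, show what = (what - u) + u by abel]
  refine (norm_sub_proj_add_le _ _ _).trans ?_
  have h1 : ‖(what - u) - proj Λ (what - u)‖ ≤ a := by
    refine (norm_sub_proj_le _ _).trans ?_
    rwa [norm_sub_rev]
  linarith

theorem IsRun.isGalerkin {P : EllipticData} {f : Hm1} {θ tol : ℝ} {J M : ℕ}
    {Lam LamHat : ℕ → Finset N2} {un uHat : ℕ → H10}
    (h : IsRun P f θ tol J M Lam LamHat un uHat) {n : ℕ} (hn : n ≤ M) :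
    P.IsGalerkin f (Lam n) (un n) := by
  cases n with
  | zero =>
    rw [h.init_set, h.init_sol]
    exact P.isGalerkin_empty f
  | succ n => exact h.corrector_sol n hn

/-- One iteration of the algorithm: the new error is controlled by the old residual, and the new
active set is not larger than any set resolving the solution to a comparable accuracy. -/
theorem IsRun.step {P : EllipticData} {B : Matrix N2 N2 ℝ} {Cinv γ θ tol : ℝ}
    (hB : IsInverse P.stiffness B) (hγ : 0 < γ)
    (htrunc : ∀ J : ℕ, OpNormLe (B - trunc J B) (Cinv * Real.exp (-γ * (J : ℝ))))
    (hθ : 0 < θ) (hθ1 : θ < 1) {f : Hm1} {u : H10} (hu : P.IsSolution f u) {M : ℕ}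
    {Lam LamHat : ℕ → Finset N2} {un uHat : ℕ → H10}
    (h : IsRun P f θ tol (enrichRadius P Cinv γ θ) M Lam LamHat un uHat) {n : ℕ} (hn : n < M) :
    ‖u - un (n + 1)‖ ≤
        8 * P.quasiOpt * (√(1 - θ ^ 2) * ‖P.residual f (un n)‖ / P.alphaLo) ∧
      ∀ Λ : Finset N2,
        ‖u - proj Λ u‖ ≤ 1 / 2 * (√(1 - θ ^ 2) * ‖P.residual f (un n)‖ / P.alphaLo) →
        (Lam (n + 1)).card ≤ Λ.card := by
  obtain ⟨S, hS, hhat⟩ := h.predictor_set n hn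
  have hgal := h.predictor_sol n hn
  have hcoarse := h.corrector_set n hn
  have hb0 : 0 ≤ √(1 - θ ^ 2) * ‖P.residual f (un n)‖ / P.alphaLo := by
    have := P.alphaLo_pos
    positivity
  have hpred : ‖u - uHat (n + 1)‖ ≤
      13 / 4 * (√(1 - θ ^ 2) * ‖P.residual f (un n)‖ / P.alphaLo) := by
    have hg := hgal
    rw [hhat] at hg
    exact predictor_error_le hB (htrunc _) (enrichRadius_spec P Cinv hγ hθ hθ1).2 hθ.le hθ1.le hu
      (h.isGalerkin hn.le).1 hS.1 hg
  -- The tolerance is `4 β`; the predictor uses `13/4 β`, so an approximation of `u` to `β / 2` fits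
  -- in what remains.
  have heps : 2 * (2 / P.alphaLo * √(1 - θ ^ 2) * ‖P.residual f (un n)‖) =
      4 * (√(1 - θ ^ 2) * ‖P.residual f (un n)‖ / P.alphaLo) := by ring
  refine ⟨?_, fun Λ hΛ => hcoarse.card_le hgal.1 hpred hΛ (by rw [heps]; linarith)⟩
  -- Compare with the coarsened predictor, whose error is at most `(13/4 + 4) β ≤ 8 β`.
  have h1 := (h.corrector_sol n hn).norm_sub_le hu (proj_mem_VLam (Lam (n + 1)) (uHat (n + 1)))
  refine h1.trans ?_
  rw [mul_comm 8, mul_assoc]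
  refine mul_le_mul_of_nonneg_left ?_ P.quasiOpt_pos.le
  have h2 := hcoarse.2.1
  rw [heps] at h2
  calc ‖u - proj (Lam (n + 1)) (uHat (n + 1))‖
      ≤ ‖u - uHat (n + 1)‖ + ‖uHat (n + 1) - proj (Lam (n + 1)) (uHat (n + 1))‖ :=
        norm_sub_le_norm_sub_add_norm_sub _ _ _
    _ ≤ _ := by linarith

theorem exp_log_div_add_log {A d C : ℝ} (hA : 0 < A) (hd : 0 < d) (hC : 0 < C) :
    Real.exp (Real.log (A / d) + Real.log C) = C * A / d := by
  rw [Real.exp_add, Real.exp_log (div_pos hA hd), Real.exp_log hC]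
  ring

theorem log_div_add_log_nonneg {A d C : ℝ} (hA : 0 < A) (hd : 0 < d) (hC : 0 < C)
    (h : d ≤ C * A) : 0 ≤ Real.log (A / d) + Real.log C := by
  rw [← Real.log_mul (div_pos hA hd).ne' hC.ne']
  refine Real.log_nonneg ?_
  rw [div_mul_eq_mul_div, le_div_iff₀ hd]
  linarith

/-- Cardinality of the active sets of **PC-ADLEG**. -/
theorem exists_card_active_le (P : EllipticData) {B : Matrix N2 N2 ℝ} {Cinv γ : ℝ} (hγ : 0 < γ)
    (hB : IsInverse P.stiffness B)
    (htrunc : ∀ J : ℕ, OpNormLe (B - trunc J B) (Cinv * Real.exp (-γ * (J : ℝ))))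
    {η t : ℝ} (hη : 0 < η) (ht : 0 < t) :
    ∃ C : ℝ, 1 < C ∧ ∀ (θ tol : ℝ), 0 < θ → θ < 1 →
      ∀ (f : Hm1) (u : H10), P.IsSolution f u → InClass (bestErr u) η t →
      ∀ (M : ℕ) (Lam LamHat : ℕ → Finset N2) (un uHat : ℕ → H10),
        IsRun P f θ tol (enrichRadius P Cinv γ θ) M Lam LamHat un uHat →
        ∀ n ≤ M, un n ≠ u →
          0 ≤ Real.log (classNorm (bestErr u) η t / ‖u - un n‖) + Real.log C ∧
          ((Lam n).card : ℝ) ≤ 1 / η ^ (1 / t) *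
            (Real.log (classNorm (bestErr u) η t / ‖u - un n‖) + Real.log C) ^ (1 / t) + 1 := by
  have hq := P.quasiOpt_pos
  -- Reaching accuracy `β / 2` needs `4 ‖u - u_{n+1}‖ ≤ C β`, and the error is at most `8 β` times
  -- the quasi-optimality constant; the `2` ensures `C > 1`.
  refine ⟨32 * P.quasiOpt + 2, by linarith, ?_⟩
  intro θ tol hθ hθ1 f u hu hcl M Lam LamHat un uHat hrun n hn hne
  have hd : 0 < ‖u - un n‖ := norm_pos_iff.2 (sub_ne_zero.2 hne.symm)
  have hcea := (hrun.isGalerkin hn).norm_sub_le_norm hu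
  have hu0 : 0 < ‖u‖ := by
    by_contra! h0
    have : ‖u‖ = 0 := le_antisymm h0 (norm_nonneg _)
    rw [this, mul_zero] at hcea
    linarith
  have hA := norm_le_classNorm ht hcl
  set A := classNorm (bestErr u) η t
  have hA0 : 0 < A := hu0.trans_le hA
  have hC0 : 0 < 32 * P.quasiOpt + 2 := by linarith
  have hnn : 0 ≤ Real.log (A / ‖u - un n‖) + Real.log (32 * P.quasiOpt + 2) := by
    refine log_div_add_log_nonneg hA0 hd hC0 (hcea.trans ?_)
    exact mul_le_mul (by linarith) hA hu0.le hC0.le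
  refine ⟨hnn, ?_⟩
  cases n with
  | zero =>
    rw [hrun.init_set, Finset.card_empty, Nat.cast_zero]
    have : 0 ≤ 1 / η ^ (1 / t) := by positivity
    have := mul_nonneg this (Real.rpow_nonneg hnn (1 / t))
    linarith
  | succ n =>
    obtain ⟨h1, h2⟩ := hrun.step hB hγ htrunc hθ hθ1 hu (Nat.lt_of_succ_le hn)
    set β := √(1 - θ ^ 2) * ‖P.residual f (un n)‖ / P.alphaLo
    -- If `β` were zero, the new iterate would already equal `u`.
    have hβ : 0 < β := by
      by_contra! h0
      have : 8 * P.quasiOpt * β ≤ 0 := mul_nonpos_of_nonneg_of_nonpos (by positivity) h0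
      linarith
    obtain ⟨S, hS, hcard⟩ := exists_card_le_of_inClass hη ht hcl (ε := 1 / 2 * β)
      (by positivity) hnn (by
        rw [exp_log_div_add_log hA0 hd hC0, mul_div_assoc', le_div_iff₀ hd]
        have h3 := mul_le_mul_of_nonneg_left h1 (mul_nonneg zero_le_two hA0.le)
        have h4 : 0 ≤ β * A := by positivity
        calc _ ≤ _ := h3
          _ ≤ _ := by nlinarith)
    exact le_trans (by exact_mod_cast h2 S hS) hcard

/-! ### Optimality of the cardinality bound -/

/-- Remove the largest element `m`: it is at least the number of remaining elements, so its term is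
dominated by the next one of the initial segment. -/
theorem sum_le_sum_range_of_antitone {a : ℕ → ℝ} (ha : Antitone a) (S : Finset ℕ) :
    ∑ i ∈ S, a i ≤ ∑ i ∈ Finset.range S.card, a i := by
  induction S using Finset.induction_on_max with
  | empty => simp
  | insert m S hm ih =>
    have hmS : m ∉ S := fun h => lt_irrefl m (hm m h)
    have hcard : S.card ≤ m := by
      simpa using Finset.card_le_card fun x hx => Finset.mem_range.2 (hm x hx)
    rw [Finset.sum_insert hmS, Finset.card_insert_of_notMem hmS, Finset.sum_range_succ, add_comm]
    exact add_le_add ih (ha hcard)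

/-- The index set `ℕ₂` is in bijection with `ℕ`. -/
def equivNat : N2 ≃ ℕ where
  toFun k := k.1 - 2
  invFun n := ⟨n + 2, by omega⟩
  left_inv k := Subtype.ext (Nat.sub_add_cancel k.2)
  right_inv n := by simp

/-- Midpoint concavity of `x ^ t`, followed by the arithmetic–geometric mean inequality. It says
that `exp (-2 η j^t)` is a convex sequence, so its successive differences decrease. -/
theorem two_mul_exp_le {η t : ℝ} (hη : 0 < η) (ht : 0 < t) (ht1 : t ≤ 1) (j : ℕ) :
    2 * Real.exp (-(2 * η * ((j + 1 : ℕ) : ℝ) ^ t)) ≤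
      Real.exp (-(2 * η * (j : ℝ) ^ t)) + Real.exp (-(2 * η * ((j + 2 : ℕ) : ℝ) ^ t)) := by
  have hconc := (Real.concaveOn_rpow ht.le ht1).2
    (mem_Ici.2 (Nat.cast_nonneg j))
    (mem_Ici.2 (Nat.cast_nonneg (j + 2)))
    (show (0 : ℝ) ≤ 1 / 2 by norm_num) (show (0 : ℝ) ≤ 1 / 2 by norm_num) (by norm_num)
  have hmid : (1 / 2 : ℝ) • (j : ℝ) + (1 / 2 : ℝ) • ((j + 2 : ℕ) : ℝ) = ((j + 1 : ℕ) : ℝ) := by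
    push_cast
    simp only [smul_eq_mul]
    ring
  simp only [hmid] at hconc
  simp only [smul_eq_mul] at hconc
  set p := (j : ℝ) ^ t
  set q := ((j + 2 : ℕ) : ℝ) ^ t
  set m := ((j + 1 : ℕ) : ℝ) ^ t
  have h1 : Real.exp (-(2 * η * m)) ≤ Real.exp (-(η * p)) * Real.exp (-(η * q)) := by
    rw [← Real.exp_add]
    refine Real.exp_le_exp.2 ?_
    nlinarith
  have h2 : ∀ y, Real.exp (-(2 * η * y)) = Real.exp (-(η * y)) ^ 2 := by
    intro y
    rw [← Real.exp_nat_mul]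
    congr 1
    push_cast
    ring
  rw [h2 p, h2 q]
  nlinarith [sq_nonneg (Real.exp (-(η * p)) - Real.exp (-(η * q)))]

/-- For any summable antitone sequence of nonnegative numbers there is a function with these
squared coefficients; its best `N`-term approximation keeps the first `N` coefficients. -/
theorem exists_bestErr_sq_eq {a : ℕ → ℝ} (h0 : ∀ j, 0 ≤ a j) (ha : Antitone a) {s : ℝ}
    (hs : HasSum a s) : ∃ v : H10, ‖v‖ ^ 2 = s ∧
      (∀ N, bestErr v N ^ 2 ≤ s - ∑ j ∈ Finset.range N, a j) ∧
      ∀ S : Finset N2, s - ∑ j ∈ Finset.range S.card, a j ≤ ‖v - proj S v‖ ^ 2 := by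
  have hs' : HasSum (fun k : N2 => a (equivNat k)) s := equivNat.hasSum_iff.2 hs
  have hmem : Memℓp (fun k : N2 => √(a (equivNat k))) 2 := by
    refine memℓp_gen ?_
    simpa [Real.norm_eq_abs, sq_abs, Real.sq_sqrt, h0] using hs'.summable
  set v : H10 := etaBasis.repr.symm ⟨_, hmem⟩ with hv
  have hc : ∀ k, coeff v k ^ 2 = a (equivNat k) := by
    intro k
    rw [coeff_eq_repr, hv, LinearIsometryEquiv.apply_symm_apply]
    exact Real.sq_sqrt (h0 _)
  have hnorm : ‖v‖ ^ 2 = s := by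
    refine (hasSum_coeff_sq v).unique ?_
    simpa only [hc] using hs'
  have herr : ∀ S : Finset N2, ‖v - proj S v‖ ^ 2 = s - ∑ j ∈ S.map equivNat.toEmbedding, a j := by
    intro S
    rw [norm_sub_proj_sq, hnorm, norm_proj_sq, Finset.sum_map]
    simp only [hc]
    rfl
  refine ⟨v, hnorm, fun N => ?_, fun S => ?_⟩
  · have h1 := herr ((Finset.range N).map equivNat.symm.toEmbedding)
    rw [Finset.map_map] at h1
    have h2 := bestErr_le (S := (Finset.range N).map equivNat.symm.toEmbedding) (N := N)
      (by simp) v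
    have h3 := pow_le_pow_left₀ (bestErr_nonneg v N) h2 2
    rw [h1] at h3
    simpa using h3
  · rw [herr]
    have := sum_le_sum_range_of_antitone ha (S.map equivNat.toEmbedding)
    rw [Finset.card_map] at this
    linarith

/-- An element of given class norm whose approximation to accuracy `ε` needs as many terms as the
class norm allows. -/
theorem exists_card_ge_of_norm_sub_proj_le {η t : ℝ} (hη : 0 < η) (ht : 0 < t) (ht1 : t ≤ 1)
    {K ε : ℝ} (hε : 0 < ε) (hK : ε < K) : ∃ v : H10, InClass (bestErr v) η t ∧
      classNorm (bestErr v) η t = K ∧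
      ∀ S : Finset N2, ‖v - proj S v‖ ≤ ε →
        1 / η ^ (1 / t) * (Real.log (K / ε)) ^ (1 / t) ≤ (S.card : ℝ) := by
  have hK0 : 0 < K := hε.trans hK
  set g : ℕ → ℝ := fun j => Real.exp (-(2 * η * (j : ℝ) ^ t)) with hg
  have hg0 : g 0 = 1 := by simp [hg, Real.zero_rpow ht.ne']
  have hganti : Antitone g := fun i j hij => by
    simp only [hg]
    gcongr
  have hglim : Filter.Tendsto g Filter.atTop (nhds 0) := by
    have h1 : Filter.Tendsto (fun j : ℕ => (j : ℝ) ^ t) Filter.atTop Filter.atTop :=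
      (tendsto_rpow_atTop ht).comp tendsto_natCast_atTop_atTop
    have h2 := h1.const_mul_atTop (show 0 < 2 * η by positivity)
    exact Real.tendsto_exp_neg_atTop_nhds_zero.comp h2
  -- Telescoping differences make the tail after `N` terms equal to `K² g N`, the square of the
  -- prescribed error.
  set a : ℕ → ℝ := fun j => K ^ 2 * (g j - g (j + 1)) with ha
  have hsum : ∀ N, ∑ j ∈ Finset.range N, a j = K ^ 2 * (1 - g N) := by
    intro N
    rw [← hg0, ← Finset.sum_range_sub' g N, Finset.mul_sum]
  have ha0 : ∀ j, 0 ≤ a j := fun j =>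
    mul_nonneg (sq_nonneg K) (sub_nonneg.2 (hganti (Nat.le_succ j)))
  have haanti : Antitone a := antitone_nat_of_succ_le fun j => by
    refine mul_le_mul_of_nonneg_left ?_ (sq_nonneg K)
    have := two_mul_exp_le hη ht ht1 j
    change 2 * g (j + 1) ≤ g j + g (j + 2) at this
    linarith
  have hasum : HasSum a (K ^ 2) := by
    rw [hasSum_iff_tendsto_nat_of_nonneg ha0]
    simp only [hsum]
    have := (hglim.const_sub 1).const_mul (K ^ 2)
    simpa using this
  obtain ⟨v, hv, hup, hlow⟩ := exists_bestErr_sq_eq ha0 haanti hasum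
  have hsq : ∀ N : ℕ, K ^ 2 - ∑ j ∈ Finset.range N, a j =
      (K * Real.exp (-(η * (N : ℝ) ^ t))) ^ 2 := by
    intro N
    rw [hsum, mul_pow, ← Real.exp_nat_mul]
    simp only [hg]
    rw [show ((2 : ℕ) : ℝ) * -(η * (N : ℝ) ^ t) = -(2 * η * (N : ℝ) ^ t) by push_cast; ring]
    ring
  have hvn : ‖v‖ = K := (sq_eq_sq₀ (norm_nonneg v) hK0.le).1 hv
  obtain ⟨hcl, hle⟩ := inClass_of_forall_le (E := bestErr v) (η := η) (t := t) (K := K) fun N => by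
    rw [← sq_le_sq₀ (bestErr_nonneg v N) (by positivity), ← hsq]
    exact hup N
  -- The lower bound for the class norm comes from `N = 0`, because `‖v‖ = K`.
  refine ⟨v, hcl, le_antisymm hle (hvn ▸ norm_le_classNorm ht hcl), fun S hS => ?_⟩
  have h1 : K * Real.exp (-(η * (S.card : ℝ) ^ t)) ≤ ε := by
    refine le_trans ?_ hS
    rw [← sq_le_sq₀ (by positivity) (norm_nonneg _), ← hsq]
    exact hlow S
  have hlog : 0 ≤ Real.log (K / ε) := Real.log_nonneg (by rw [one_le_div hε]; exact hK.le)
  have h2 : Real.log (K / ε) ≤ η * (S.card : ℝ) ^ t := by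
    rw [Real.log_le_iff_le_exp (by positivity), div_le_iff₀ hε]
    rw [Real.exp_neg, ← div_eq_mul_inv, div_le_iff₀ (Real.exp_pos _)] at h1
    linarith
  rw [one_div_mul_eq_div, ← Real.div_rpow hlog hη.le]
  calc (Real.log (K / ε) / η) ^ (1 / t) ≤ ((S.card : ℝ) ^ t) ^ (1 / t) := by
        refine Real.rpow_le_rpow (by positivity) ?_ (by positivity)
        rw [div_le_iff₀ hη]
        linarith
    _ = S.card := by
        rw [← Real.rpow_mul (by positivity), mul_one_div_cancel ht.ne', Real.rpow_one]

/-! ### Sums of exponentials -/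

theorem dist_N2 (m n : N2) : dist m n = |(m.1 : ℝ) - (n.1 : ℝ)| := rfl

/-- The shift by `k` embeds the indices in `ℤ`, so a single two-sided geometric series bounds all
these sums. -/
theorem exists_sum_exp_dist_le {γ : ℝ} (hγ : 0 < γ) :
    ∃ G : ℝ, 0 < G ∧ ∀ (k : N2) (S : Finset N2), ∑ j ∈ S, Real.exp (-γ * dist j k) ≤ G := by
  have hs : Summable fun d : ℤ => Real.exp (-γ * |(d : ℝ)|) := by
    have hn : Summable fun n : ℕ => Real.exp (-γ * (n : ℝ)) := by
      simpa only [mul_comm] using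
        Real.summable_exp_nat_mul_iff.2 (neg_lt_zero.2 hγ)
    refine Summable.of_nat_of_neg ?_ ?_ <;> simpa using hn
  refine ⟨(∑' d : ℤ, Real.exp (-γ * |(d : ℝ)|)), ?_, fun k S => ?_⟩
  · refine (Real.exp_pos _).trans_le (hs.le_tsum 0 fun _ _ => (Real.exp_pos _).le)
  · have hinj : Function.Injective fun j : N2 => (j.1 : ℤ) - (k.1 : ℤ) := fun a b h => by
      refine Subtype.ext ?_
      have h' : (a.1 : ℤ) - k.1 = b.1 - k.1 := h
      omega
    have h1 := hs.sum_le_tsum (S.map ⟨_, hinj⟩) fun _ _ => (Real.exp_pos _).le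
    rw [Finset.sum_map] at h1
    refine le_of_eq_of_le (Finset.sum_congr rfl fun j _ => ?_) h1
    rw [dist_N2]
    simp

/-- The Schur test for a symmetric kernel on a finite set. -/
theorem sum_sum_mul_abs_le {ι : Type*} {S : Finset ι} {K : ι → ι → ℝ} {κ : ℝ}
    (hK0 : ∀ i j, 0 ≤ K i j) (hsymm : ∀ i j, K i j = K j i)
    (hK : ∀ i ∈ S, ∑ j ∈ S, K j i ≤ κ) (x : ι → ℝ) :
    ∑ i ∈ S, ∑ j ∈ S, K i j * (|x i| * |x j|) ≤ κ * ∑ i ∈ S, x i ^ 2 := by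
  have h1 : ∑ i ∈ S, ∑ j ∈ S, K i j * x i ^ 2 ≤ κ * ∑ i ∈ S, x i ^ 2 := by
    rw [Finset.mul_sum]
    refine Finset.sum_le_sum fun i hi => ?_
    rw [← Finset.sum_mul]
    refine mul_le_mul_of_nonneg_right ?_ (sq_nonneg _)
    simpa only [hsymm i] using hK i hi
  have h2 : ∑ i ∈ S, ∑ j ∈ S, K i j * x j ^ 2 ≤ κ * ∑ i ∈ S, x i ^ 2 := by
    rw [Finset.sum_comm]
    simpa only [hsymm] using h1
  have h3 : ∑ i ∈ S, ∑ j ∈ S, K i j * (|x i| * |x j|) ≤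
      ∑ i ∈ S, ∑ j ∈ S, (K i j * x i ^ 2 + K i j * x j ^ 2) / 2 := by
    refine Finset.sum_le_sum fun i _ => Finset.sum_le_sum fun j _ => ?_
    rw [← mul_add, mul_div_assoc]
    refine mul_le_mul_of_nonneg_left ?_ (hK0 i j)
    have := two_mul_le_add_sq (|x i|) (|x j|)
    rw [sq_abs, sq_abs] at this
    linarith
  simp only [← Finset.sum_div, Finset.sum_add_distrib] at h3
  linarith

/-! ### Off-diagonal decay of Galerkin approximations -/

theorem abs_exp_sub_one_le_exp_abs_sub_one (y : ℝ) : |Real.exp y - 1| ≤ Real.exp |y| - 1 := by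
  rcases le_total 0 y with h | h
  · rw [abs_of_nonneg h, abs_of_nonneg (by linarith [Real.one_le_exp h])]
  · rw [abs_of_nonpos h, abs_of_nonpos (by linarith [Real.exp_le_one_iff.2 h]), Real.exp_neg]
    have h1 := Real.exp_pos y
    have h2 := sq_nonneg (Real.exp y - 1)
    have h3 : 2 ≤ Real.exp y + (Real.exp y)⁻¹ := by
      rw [← sub_nonneg]
      have : Real.exp y + (Real.exp y)⁻¹ - 2 = (Real.exp y - 1) ^ 2 / Real.exp y := by
        field_simp
        ring
      rw [this]
      positivity
    linarith

theorem exp_sub_one_le_mul_exp (y : ℝ) : Real.exp y - 1 ≤ y * Real.exp y := by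
  have h1 := Real.add_one_le_exp (-y)
  rw [Real.exp_neg] at h1
  have h2 := Real.exp_pos y
  have h3 := mul_le_mul_of_nonneg_right h1 h2.le
  rw [inv_mul_cancel₀ h2.ne'] at h3
  linarith

/-- Bounds the commutator kernel. Half of the decay is spent, one quarter on `exp (ω d)` and one on
the linear factor `ω d`; the gain is a prefactor that is small with `ω`. -/
theorem exp_decay_mul_exp_sub_one_le {γ ω d : ℝ} (hγ : 0 < γ) (hω : 0 < ω) (hωγ : ω ≤ γ / 4)
    (hd : 0 ≤ d) :
    Real.exp (-γ * d) * (Real.exp (ω * d) - 1) ≤ 4 * ω / γ * Real.exp (-(γ / 2) * d) := by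
  have h1 : Real.exp (ω * d) - 1 ≤ ω * d * Real.exp (γ / 4 * d) :=
    (exp_sub_one_le_mul_exp _).trans (by gcongr)
  have h2 : γ / 4 * d ≤ Real.exp (γ / 4 * d) := by linarith [Real.add_one_le_exp (γ / 4 * d)]
  have h3 : ω * d ≤ 4 * ω / γ * Real.exp (γ / 4 * d) := by
    calc ω * d = 4 * ω / γ * (γ / 4 * d) := by field_simp
      _ ≤ _ := by gcongr
  calc Real.exp (-γ * d) * (Real.exp (ω * d) - 1)
      ≤ Real.exp (-γ * d) * (4 * ω / γ * Real.exp (γ / 4 * d) * Real.exp (γ / 4 * d)) := by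
        refine mul_le_mul_of_nonneg_left (h1.trans ?_) (Real.exp_pos _).le
        gcongr
    _ = 4 * ω / γ * (Real.exp (-γ * d) * Real.exp (γ / 4 * d) * Real.exp (γ / 4 * d)) := by ring
    _ = _ := by
        rw [← Real.exp_add, ← Real.exp_add]
        ring_nf

namespace EllipticData

variable (P : EllipticData)

theorem form_sum_left {ι : Type*} (S : Finset ι) (v : ι → H10) (w : H10) :
    P.form (∑ i ∈ S, v i) w = ∑ i ∈ S, P.form (v i) w := by
  simp only [← P.L_apply, map_sum, _root_.sum_apply]

theorem form_sum_right {ι : Type*} (S : Finset ι) (v : H10) (w : ι → H10) :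
    P.form v (∑ i ∈ S, w i) = ∑ i ∈ S, P.form v (w i) := by
  simp only [← P.L_apply, map_sum]

theorem form_sum_sum (S : Finset N2) (a b : N2 → ℝ) :
    P.form (∑ i ∈ S, a i • eta i) (∑ j ∈ S, b j • eta j) =
      ∑ i ∈ S, ∑ j ∈ S, a i * b j * P.form (eta i) (eta j) := by
  rw [form_sum_left]
  refine Finset.sum_congr rfl fun i _ => ?_
  rw [form_sum_right]
  refine Finset.sum_congr rfl fun j _ => ?_
  rw [form_smul_left, form_smul_right]
  ring

theorem exists_isGalerkin (f : Hm1) (S : Finset N2) : ∃ w, P.IsGalerkin f S w := by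
  have : FiniteDimensional ℝ (VLam S) :=
    FiniteDimensional.span_of_finite ℝ ((Finset.finite_toSet S).image eta)
  let φ : VLam S →ₗ[ℝ] Module.Dual ℝ (VLam S) :=
    LinearMap.mk₂ ℝ (fun v w : VLam S => P.form v w) (fun v w z => P.form_add_left _ _ _)
      (fun c v w => P.form_smul_left _ _ _) (fun v w z => P.form_add_right _ _ _)
      (fun c v w => P.form_smul_right _ _ _)
  have hinj : Function.Injective φ := by
    rw [← LinearMap.ker_eq_bot, LinearMap.ker_eq_bot']
    intro v hv
    have h : P.form v v = 0 := congrArg (fun ψ : Module.Dual ℝ (VLam S) => ψ v) hv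
    have h1 := P.alphaLo_mul_norm_sq_le v
    rw [h] at h1
    have h2 : ‖(v : H10)‖ ^ 2 ≤ 0 := by
      by_contra! h3
      have := mul_pos P.alphaLo_pos h3
      linarith
    refine Subtype.ext (norm_eq_zero.1 ?_)
    exact pow_eq_zero_iff two_ne_zero |>.1 (le_antisymm h2 (sq_nonneg _))
  obtain ⟨w, hw⟩ := (LinearMap.injective_iff_surjective_of_finrank_eq_finrank
    Subspace.dual_finrank_eq.symm).1 hinj ((f : H10 →ₗ[ℝ] ℝ).comp (VLam S).subtype)
  exact ⟨w, w.2, fun v hv =>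
    congrArg (fun ψ : Module.Dual ℝ (VLam S) => ψ ⟨v, hv⟩) hw⟩

variable {P}

theorem IsGalerkin.sub {f g : Hm1} {S : Finset N2} {v w : H10} (hv : P.IsGalerkin f S v)
    (hw : P.IsGalerkin g S w) : P.IsGalerkin (f - g) S (v - w) :=
  ⟨Submodule.sub_mem _ hv.1 hw.1, fun z hz => by
    rw [form_sub_left, hv.2 z hz, hw.2 z hz]
    rfl⟩

theorem IsGalerkin.sum_smul {S T : Finset N2} {c : N2 → ℝ} {v g : N2 → H10}
    (hg : ∀ k, P.IsGalerkin (P.L (v k)) S (g k)) :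
    P.IsGalerkin (P.L (∑ k ∈ T, c k • v k)) S (∑ k ∈ T, c k • g k) := by
  refine ⟨Submodule.sum_mem _ fun k _ => Submodule.smul_mem _ _ (hg k).1, fun z hz => ?_⟩
  rw [P.L_apply, form_sum_left, form_sum_left]
  refine Finset.sum_congr rfl fun k _ => ?_
  rw [form_smul_left, form_smul_left, (hg k).2 z hz, P.L_apply]

end EllipticData

/-- The weighted energy estimate behind the decay of Galerkin approximations. -/
theorem weighted_norm_le {P : EllipticData} {c γ ω G : ℝ} (hc : 0 < c) (hγ : 0 < γ)
    (hA : ∀ m n : N2, |P.form (eta m) (eta n)| ≤ c * Real.exp (-γ * dist m n))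
    (hG0 : 0 < G)
    (hG : ∀ (k : N2) (S : Finset N2), ∑ j ∈ S, Real.exp (-(γ / 2) * dist j k) ≤ G)
    (hω : 0 < ω) (hωγ : ω ≤ γ / 4) (hωG : c * (4 * ω / γ) * G ≤ P.alphaLo / 2)
    {k : N2} {Λ : Finset N2} {g : H10} (hg : P.IsGalerkin (P.L (eta k)) Λ g) :
    ‖∑ j ∈ Λ, (Real.exp (ω * dist j k) * coeff g j) • eta j‖ ≤ 2 * c * G / P.alphaLo := by
  set W : N2 → ℝ := fun j => Real.exp (ω * dist j k) with hW
  set h : N2 → ℝ := fun j => W j * coeff g j with hh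
  set H : H10 := ∑ j ∈ Λ, h j • eta j with hH
  -- The Galerkin equation for `g` is tested with the coefficients `W² g`, so that `a(g, z)` becomes
  -- `a(H, H)` up to a commutator.
  set z : H10 := ∑ j ∈ Λ, (W j * h j) • eta j with hz
  have hW0 : ∀ j, 0 < W j := fun j => Real.exp_pos _
  have hα := P.alphaLo_pos
  have hgsum : g = ∑ j ∈ Λ, coeff g j • eta j := (proj_eq_self hg.1).symm
  have hHsq : ‖H‖ ^ 2 = ∑ j ∈ Λ, h j ^ 2 := norm_sum_smul_eta_sq Λ h
  have hhH : ∀ j ∈ Λ, |h j| ≤ ‖H‖ := by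
    intro j hj
    have := abs_coeff_le H j
    rwa [hH, coeff_sum_smul_eta, if_pos hj] at this
  -- the commutator term
  have hcomm : P.form H H - P.form g z ≤ P.alphaLo / 2 * ‖H‖ ^ 2 := by
    have e1 : P.form H H - P.form g z =
        ∑ i ∈ Λ, ∑ j ∈ Λ, h i * h j * P.form (eta i) (eta j) * (1 - W j / W i) := by
      conv_lhs => rw [hgsum]
      rw [hH, hz, P.form_sum_sum, P.form_sum_sum, ← Finset.sum_sub_distrib]
      refine Finset.sum_congr rfl fun i _ => ?_
      rw [← Finset.sum_sub_distrib]
      refine Finset.sum_congr rfl fun j _ => ?_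
      have : coeff g i = h i / W i := by
        rw [hh]
        field_simp [(hW0 i).ne']
      rw [this]
      ring
    have e2 : ∀ i j, h i * h j * P.form (eta i) (eta j) * (1 - W j / W i) ≤
        c * (4 * ω / γ) * Real.exp (-(γ / 2) * dist i j) * (|h i| * |h j|) := by
      intro i j
      -- The logarithm of the weight is Lipschitz with constant `ω`, by the triangle inequality.
      have h1 : |1 - W j / W i| ≤ Real.exp (ω * dist i j) - 1 := by
        rw [hW, ← Real.exp_sub, abs_sub_comm]
        refine (abs_exp_sub_one_le_exp_abs_sub_one _).trans ?_
        refine sub_le_sub_right (Real.exp_le_exp.2 ?_) 1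
        rw [← mul_sub, abs_mul, abs_of_pos hω]
        refine mul_le_mul_of_nonneg_left ?_ hω.le
        rw [dist_comm i j]
        exact abs_dist_sub_le j i k
      have h2 := exp_decay_mul_exp_sub_one_le hγ hω hωγ (dist_nonneg (x := i) (y := j))
      have h3 : |P.form (eta i) (eta j)| * |1 - W j / W i| ≤
          c * (4 * ω / γ) * Real.exp (-(γ / 2) * dist i j) := by
        calc _ ≤ c * Real.exp (-γ * dist i j) * (Real.exp (ω * dist i j) - 1) :=
              mul_le_mul (hA i j) h1 (abs_nonneg _) (by positivity)
          _ ≤ _ := by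
              rw [mul_assoc, mul_assoc]
              exact mul_le_mul_of_nonneg_left h2 hc.le
      calc _ ≤ |h i * h j * P.form (eta i) (eta j) * (1 - W j / W i)| := le_abs_self _
        _ = |P.form (eta i) (eta j)| * |1 - W j / W i| * (|h i| * |h j|) := by
            rw [abs_mul, abs_mul, abs_mul]
            ring
        _ ≤ _ := mul_le_mul_of_nonneg_right h3 (by positivity)
    rw [e1]
    refine (Finset.sum_le_sum fun i _ => Finset.sum_le_sum fun j _ => e2 i j).trans ?_
    refine (sum_sum_mul_abs_le
      (K := fun i j => c * (4 * ω / γ) * Real.exp (-(γ / 2) * dist i j))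
      (κ := c * (4 * ω / γ) * G) (fun i j => by positivity)
      (fun i j => by simp only [dist_comm]) (fun i _ => ?_) h).trans ?_
    · rw [← Finset.mul_sum]
      exact mul_le_mul_of_nonneg_left (hG i Λ) (by positivity)
    · rw [← hHsq]
      exact mul_le_mul_of_nonneg_right hωG (sq_nonneg _)
  -- the right-hand side
  have hrhs : P.form g z ≤ c * G * ‖H‖ := by
    have hzmem : z ∈ VLam Λ := sum_smul_eta_mem_VLam Λ _
    rw [hg.2 z hzmem, P.L_apply, hz, P.form_sum_right, mul_assoc, mul_comm G, ← mul_assoc]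
    calc ∑ j ∈ Λ, P.form (eta k) ((W j * h j) • eta j)
        ≤ ∑ j ∈ Λ, c * ‖H‖ * Real.exp (-(γ / 2) * dist j k) := by
          refine Finset.sum_le_sum fun j hj => ?_
          rw [P.form_smul_right]
          refine (le_abs_self _).trans ?_
          rw [abs_mul, abs_mul, abs_of_pos (hW0 j)]
          have h1 : W j * Real.exp (-γ * dist k j) ≤ Real.exp (-(γ / 2) * dist j k) := by
            rw [hW, dist_comm k j, ← Real.exp_add]
            refine Real.exp_le_exp.2 ?_
            have := mul_le_mul_of_nonneg_right hωγ (dist_nonneg (x := j) (y := k))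
            have := mul_nonneg hγ.le (dist_nonneg (x := j) (y := k))
            linarith
          calc W j * |h j| * |P.form (eta k) (eta j)|
              ≤ W j * ‖H‖ * (c * Real.exp (-γ * dist k j)) :=
                mul_le_mul (mul_le_mul_of_nonneg_left (hhH j hj) (hW0 j).le) (hA k j)
                  (abs_nonneg _) (mul_nonneg (hW0 j).le (norm_nonneg _))
            _ = c * ‖H‖ * (W j * Real.exp (-γ * dist k j)) := by ring
            _ ≤ _ := mul_le_mul_of_nonneg_left h1 (by positivity)
      _ = c * ‖H‖ * ∑ j ∈ Λ, Real.exp (-(γ / 2) * dist j k) := by rw [Finset.mul_sum]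
      _ ≤ c * ‖H‖ * G := mul_le_mul_of_nonneg_left (hG k Λ) (by positivity)
  have hco := P.alphaLo_mul_norm_sq_le H
  rw [le_div_iff₀ hα]
  rcases (norm_nonneg H).eq_or_lt with h0 | h0
  · rw [← h0, zero_mul]
    positivity
  · refine le_of_mul_le_mul_left ?_ h0
    nlinarith

/-- Galerkin approximations of a basis function decay exponentially away from its index, and so
do the coefficients of the corresponding residual. -/
theorem exists_residual_decay (P : EllipticData) {γ : ℝ} (hγ : 0 < γ)
    (hexp : ExpClass P.stiffness γ) :
    ∃ ω : ℝ, 0 < ω ∧ ∃ C : ℝ, 0 < C ∧ ∀ (k : N2) (Λ : Finset N2) (g : H10),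
      P.IsGalerkin (P.L (eta k)) Λ g →
      ∀ m, |P.form (eta k - g) (eta m)| ≤ C * Real.exp (-ω * dist m k) := by
  obtain ⟨c, hc, hA'⟩ := hexp
  have hA : ∀ m n : N2, |P.form (eta m) (eta n)| ≤ c * Real.exp (-γ * dist m n) := by
    intro m n
    rw [P.form_comm]
    exact hA' m n
  obtain ⟨G, hG0, hG⟩ := exists_sum_exp_dist_le (half_pos hγ)
  have hα := P.alphaLo_pos
  -- The first bound leaves enough off-diagonal decay; the second makes the commutator at most half
  -- of the coercivity constant.
  set ω := min (γ / 4) (P.alphaLo * γ / (8 * c * G)) with hωdef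
  have hω : 0 < ω := lt_min (by positivity) (by positivity)
  have hωγ : ω ≤ γ / 4 := min_le_left _ _
  have hωG : c * (4 * ω / γ) * G ≤ P.alphaLo / 2 := by
    have : ω ≤ P.alphaLo * γ / (8 * c * G) := min_le_right _ _
    rw [le_div_iff₀ (by positivity)] at this
    rw [mul_div_assoc', div_mul_eq_mul_div, div_le_iff₀ hγ]
    linarith
  set C := 2 * c * G / P.alphaLo with hC
  have hC0 : 0 < C := by positivity
  refine ⟨ω, hω, c + C * c * G, by positivity, fun k Λ g hg m => ?_⟩
  have hH := weighted_norm_le hc hγ hA hG0 hG hω hωγ hωG hg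
  have hgj : ∀ j ∈ Λ, |coeff g j| ≤ C * Real.exp (-ω * dist j k) := by
    intro j hj
    have h1 := (abs_coeff_le (∑ j ∈ Λ, (Real.exp (ω * dist j k) * coeff g j) • eta j) j).trans hH
    rw [coeff_sum_smul_eta, if_pos hj, abs_mul, abs_of_pos (Real.exp_pos _)] at h1
    rw [neg_mul, Real.exp_neg, ← div_eq_mul_inv, le_div_iff₀ (Real.exp_pos _)]
    linarith
  have hgsum : g = ∑ j ∈ Λ, coeff g j • eta j := (proj_eq_self hg.1).symm
  -- Splitting `dist m k` through `j` costs `ω` of the rate `γ`, and what is left is still summable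
  -- in `j`.
  have htri : ∀ j, Real.exp (-ω * dist j k) * Real.exp (-γ * dist j m) ≤
      Real.exp (-ω * dist m k) * Real.exp (-(γ / 2) * dist j m) := by
    intro j
    rw [← Real.exp_add, ← Real.exp_add]
    refine Real.exp_le_exp.2 ?_
    have h1 := mul_le_mul_of_nonneg_left (dist_triangle_left m k j) hω.le
    have h2 := mul_le_mul_of_nonneg_right hωγ (dist_nonneg (x := j) (y := m))
    have h3 := mul_nonneg hγ.le (dist_nonneg (x := j) (y := m))
    linarith
  have h1 : |P.form g (eta m)| ≤ C * c * G * Real.exp (-ω * dist m k) := by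
    rw [hgsum, P.form_sum_left]
    calc |∑ j ∈ Λ, P.form (coeff g j • eta j) (eta m)|
        ≤ ∑ j ∈ Λ, |P.form (coeff g j • eta j) (eta m)| := Finset.abs_sum_le_sum_abs _ _
      _ ≤ ∑ j ∈ Λ, C * c * Real.exp (-ω * dist m k) * Real.exp (-(γ / 2) * dist j m) := by
          refine Finset.sum_le_sum fun j hj => ?_
          rw [P.form_smul_left, abs_mul]
          calc |coeff g j| * |P.form (eta j) (eta m)|
              ≤ C * Real.exp (-ω * dist j k) * (c * Real.exp (-γ * dist j m)) :=
                mul_le_mul (hgj j hj) (hA j m) (abs_nonneg _) (by positivity)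
            _ = C * c * (Real.exp (-ω * dist j k) * Real.exp (-γ * dist j m)) := by ring
            _ ≤ C * c * (Real.exp (-ω * dist m k) * Real.exp (-(γ / 2) * dist j m)) :=
                mul_le_mul_of_nonneg_left (htri j) (by positivity)
            _ = _ := by ring
      _ = C * c * Real.exp (-ω * dist m k) * ∑ j ∈ Λ, Real.exp (-(γ / 2) * dist j m) := by
          rw [Finset.mul_sum]
      _ ≤ C * c * Real.exp (-ω * dist m k) * G :=
          mul_le_mul_of_nonneg_left (hG m Λ) (by positivity)
      _ = _ := by ring
  have h2 : |P.form (eta k) (eta m)| ≤ c * Real.exp (-ω * dist m k) := by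
    refine (hA k m).trans (mul_le_mul_of_nonneg_left (Real.exp_le_exp.2 ?_) hc.le)
    rw [dist_comm k m]
    have := mul_le_mul_of_nonneg_right hωγ (dist_nonneg (x := m) (y := k))
    have := mul_nonneg hγ.le (dist_nonneg (x := m) (y := k))
    linarith
  rw [P.form_sub_left]
  refine (abs_sub _ _).trans ?_
  linarith

/-- Truncation of an element with exponentially decaying coefficients. -/
theorem norm_sub_proj_le_of_decay {ω C G : ℝ} (hC : 0 ≤ C)
    (hG : ∀ (k : N2) (S : Finset N2), ∑ j ∈ S, Real.exp (-ω * dist j k) ≤ G) (hω : 0 ≤ ω)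
    {v : H10} {k : N2} (hv : ∀ m, |coeff v m| ≤ C * Real.exp (-ω * dist m k)) {J : ℕ}
    {S : Finset N2} (hS : ∀ m, m ∉ S → (J : ℝ) ≤ dist m k) :
    ‖v - proj S v‖ ≤ C * √G * Real.exp (-(ω / 2) * J) := by
  have hG0 : 0 ≤ G := by simpa using hG k ∅
  refine (sq_le_sq₀ (norm_nonneg _) (by positivity)).1 ?_
  have hrhs : (C * √G * Real.exp (-(ω / 2) * J)) ^ 2 = C ^ 2 * Real.exp (-ω * J) * G := by
    rw [mul_pow, mul_pow, Real.sq_sqrt hG0, ← Real.exp_nat_mul]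
    push_cast
    ring_nf
  rw [hrhs]
  refine hasSum_le_of_sum_le (hasSum_coeff_sq (v - proj S v)) fun T => ?_
  -- Outside `S` the squared decay `exp (-2 ω d)` splits into `exp (-ω J)` and a factor summed by
  -- `G`.
  refine le_trans (Finset.sum_le_sum (g := fun m =>
    C ^ 2 * Real.exp (-ω * J) * Real.exp (-ω * dist m k)) fun m _ => ?_) ?_
  · rw [coeff_sub, coeff_proj]
    split_ifs with hm
    · rw [sub_self, sq, zero_mul]
      positivity
    · rw [sub_zero, ← sq_abs]
      have h1 := pow_le_pow_left₀ (abs_nonneg _) (hv m) 2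
      refine h1.trans ?_
      rw [mul_pow, sq (Real.exp _), mul_assoc]
      refine mul_le_mul_of_nonneg_left (mul_le_mul_of_nonneg_right ?_ (Real.exp_pos _).le)
        (sq_nonneg C)
      refine Real.exp_le_exp.2 ?_
      have := mul_le_mul_of_nonneg_left (hS m hm) hω
      linarith
  · rw [← Finset.mul_sum]
    exact mul_le_mul_of_nonneg_left (hG k T) (by positivity)

/-! ### Sparsity of the residuals -/

theorem card_enrich_le (S : Finset N2) (J : ℕ) : (enrich S J).card ≤ S.card * (2 * J + 1) := by
  refine Finset.card_biUnion_le_card_mul _ _ _ fun l _ => ?_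
  rw [Finset.card_subtype]
  refine (Finset.card_filter_le _ _).trans ?_
  rw [Nat.card_Icc]
  omega

theorem le_dist_of_notMem_enrich {S : Finset N2} {J : ℕ} {k m : N2} (hk : k ∈ S)
    (hm : m ∉ enrich S J) : (J : ℝ) ≤ dist m k := by
  by_contra! h
  refine hm ((mem_enrich S J m).2 ⟨k, hk, ?_⟩)
  rw [dist_N2] at h
  have h' : |((m.1 : ℤ) - (k.1 : ℤ) : ℤ)| < (J : ℤ) := by
    have : ((|(m.1 : ℤ) - (k.1 : ℤ)| : ℤ) : ℝ) < ((J : ℤ) : ℝ) := by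
      push_cast
      exact h
    exact_mod_cast this
  exact h'.le

/-- Part of the exponential rate pays for the number `N` of summands in the residual approximation;
`N ^ t ≤ N` then gives the form of the class. -/
theorem natCast_mul_exp_le {ω : ℝ} (hω : 0 < ω) {t : ℝ} (ht1 : t ≤ 1) (N : ℕ) :
    (N : ℝ) * Real.exp (-(ω / 2) * N) ≤ 4 / ω * Real.exp (-(ω / 4 * (N : ℝ) ^ t)) := by
  rcases Nat.eq_zero_or_pos N with rfl | hN
  · rw [Nat.cast_zero, zero_mul]
    positivity
  have h1 : (N : ℝ) ^ t ≤ N := Real.rpow_le_self_of_one_le (by exact_mod_cast hN) ht1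
  have h2 : ω / 4 * N ≤ Real.exp (ω / 4 * N) := by linarith [Real.add_one_le_exp (ω / 4 * N)]
  calc (N : ℝ) * Real.exp (-(ω / 2) * N) = 4 / ω * (ω / 4 * N) * Real.exp (-(ω / 2) * N) := by
        field_simp
    _ ≤ 4 / ω * Real.exp (ω / 4 * N) * Real.exp (-(ω / 2) * N) := by gcongr
    _ = 4 / ω * Real.exp (-(ω / 4 * N)) := by
        rw [mul_assoc, ← Real.exp_add]
        ring_nf
    _ ≤ _ := by gcongr

theorem residual_eq_L {P : EllipticData} {f : Hm1} {u : H10} (hu : P.IsSolution f u) (w : H10) :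
    P.residual f w = P.L (u - w) := by
  ext z
  rw [EllipticData.residual_apply hu, P.L_apply]

theorem EllipticData.bound_nonneg (P : EllipticData) : 0 ≤ P.nuHi + 8 * P.sigHi := by
  have := P.nuHi_nonneg
  have := P.sigHi_nonneg
  positivity

theorem norm_riesz_L_le (P : EllipticData) (v : H10) :
    ‖riesz (P.L v)‖ ≤ (P.nuHi + 8 * P.sigHi) * ‖v‖ := by
  rw [norm_riesz]
  exact (P.L v).opNorm_le_bound (mul_nonneg P.bound_nonneg (norm_nonneg v)) (P.abs_form_le v)

/-- Residuals of Galerkin solutions are approximated by `O(N²)` terms as well as the solution is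
approximated by `N` terms, up to a change of the rate. -/
theorem exists_residual_approx (P : EllipticData) {γ : ℝ} (hγ : 0 < γ)
    (hexp : ExpClass P.stiffness γ) {η t : ℝ} (hη : 0 < η) (ht : 0 < t) (ht1 : t ≤ 1) :
    ∃ μ : ℝ, 0 < μ ∧ μ ≤ η ∧ ∃ K : ℝ, 0 < K ∧ ∀ (f : Hm1) (u : H10), P.IsSolution f u →
      InClass (bestErr u) η t → ∀ (Λ : Finset N2) (w : H10), P.IsGalerkin f Λ w →
      ∀ N : ℕ, ∃ S : Finset N2, S.card ≤ 4 * N ^ 2 ∧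
        ‖riesz (P.residual f w) - proj S (riesz (P.residual f w))‖ ≤
          K * classNorm (bestErr u) η t * Real.exp (-(μ * (N : ℝ) ^ t)) := by
  obtain ⟨ω, hω, C, hC, hdec⟩ := exists_residual_decay P hγ hexp
  obtain ⟨G, hG0, hG⟩ := exists_sum_exp_dist_le hω
  have hq := P.quasiOpt_pos
  have hL := P.bound_nonneg
  set ℓ := P.nuHi + 8 * P.sigHi with hℓ
  refine ⟨min η (ω / 4), lt_min hη (by positivity), min_le_left _ _,
    2 * ℓ * P.quasiOpt + C * √G * (4 / ω), by positivity, ?_⟩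
  intro f u hu hcl Λ w hw N
  set μ := min η (ω / 4)
  have hA := norm_le_classNorm ht hcl
  set A := classNorm (bestErr u) η t
  rw [residual_eq_L hu]
  -- If the class norm is zero then so is the error `u - w`; the strict choice of `T` below needs a
  -- positive class norm.
  rcases ((norm_nonneg u).trans hA).eq_or_lt with hA0 | hA0
  · refine ⟨∅, by simp, ?_⟩
    have h0 : ‖u - w‖ = 0 := by
      refine le_antisymm ((hw.norm_sub_le_norm hu).trans ?_) (norm_nonneg _)
      refine (mul_le_mul_of_nonneg_left hA hq.le).trans ?_
      rw [← hA0, mul_zero]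
    rw [norm_eq_zero.1 h0, map_zero, ← hA0]
    simp [riesz]
  -- sparse approximation of the solution
  have hlt : bestErr u N < 2 * (A * Real.exp (-(η * (N : ℝ) ^ t))) := by
    have h1 := bestErr_le_classNorm hcl N
    have : 0 < A * Real.exp (-(η * (N : ℝ) ^ t)) := by positivity
    linarith
  obtain ⟨T, hT, hTlt⟩ := exists_norm_sub_proj_lt hlt
  choose g hg using fun k => P.exists_isGalerkin (P.L (eta k)) Λ
  set uN := proj T u with huN
  set wN := ∑ k ∈ T, coeff u k • g k with hwN
  -- By linearity, the Galerkin solution for the sparse part is the combination of those for single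
  -- basis functions.
  have hwNgal : P.IsGalerkin (P.L uN) Λ wN := EllipticData.IsGalerkin.sum_smul hg
  have hw' : P.IsGalerkin (P.L (u - uN)) Λ (w - wN) := by
    have hf : f = P.L u := by
      ext z
      rw [P.L_apply, hu z]
    rw [map_sub, ← hf]
    exact hw.sub hwNgal
  have hrest : ‖riesz (P.L ((u - uN) - (w - wN)))‖ ≤
      2 * ℓ * P.quasiOpt * A * Real.exp (-(μ * (N : ℝ) ^ t)) := by
    refine (norm_riesz_L_le P _).trans ?_
    have h1 := hw'.norm_sub_le_norm (u := u - uN) fun z => rfl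
    have h2 : Real.exp (-(η * (N : ℝ) ^ t)) ≤ Real.exp (-(μ * (N : ℝ) ^ t)) := by
      have := min_le_left η (ω / 4)
      gcongr
    calc ℓ * ‖u - uN - (w - wN)‖
        ≤ ℓ * (P.quasiOpt * (2 * (A * Real.exp (-(μ * (N : ℝ) ^ t))))) := by
          refine mul_le_mul_of_nonneg_left (h1.trans (mul_le_mul_of_nonneg_left ?_ hq.le)) hL
          refine hTlt.le.trans ?_
          gcongr
      _ = _ := by ring
  have hmain : ∀ k ∈ T, ‖riesz (P.L (eta k - g k)) -
      proj (enrich T N) (riesz (P.L (eta k - g k)))‖ ≤ C * √G * Real.exp (-(ω / 2) * N) := by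
    intro k hk
    refine norm_sub_proj_le_of_decay hC.le hG hω.le (fun m => ?_)
      (fun m hm => le_dist_of_notMem_enrich hk hm)
    rw [coeff_riesz, P.L_apply]
    exact hdec k Λ (g k) (hg k) m
  refine ⟨enrich T N, ?_, ?_⟩
  · refine (card_enrich_le T N).trans ?_
    rw [hT]
    -- For `N ≥ 1`, `N (2 N + 1) ≤ 4 N²`.
    rcases Nat.eq_zero_or_pos N with rfl | hN
    · simp
    · nlinarith
  · set E := enrich T N
    -- `Q` is the truncation error of the residual as a linear map; it is bounded by stability on
    -- the tail of `u` and by decay on each of the `N` basis terms.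
    let Q : H10 →ₗ[ℝ] H10 :=
      { toFun := fun v => riesz (P.L v) - proj E (riesz (P.L v))
        map_add' := fun v w => by
          rw [map_add, riesz_add, proj_add]
          abel
        map_smul' := fun c v => by
          have h1 : riesz (P.L (c • v)) = c • riesz (P.L v) := by
            refine ext_coeff fun m => ?_
            rw [coeff_smul, coeff_riesz, coeff_riesz, map_smul]
            rfl
          have h2 : ∀ z : H10, proj E (c • z) = c • proj E z := fun z => by
            refine ext_coeff fun m => ?_
            rw [coeff_smul, coeff_proj, coeff_proj, coeff_smul]
            split_ifs <;> simp
          rw [RingHom.id_apply, h1, h2, smul_sub] }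
    have hsplit : Q (u - w) = Q ((u - uN) - (w - wN)) + ∑ k ∈ T, coeff u k • Q (eta k - g k) := by
      have : u - w = ((u - uN) - (w - wN)) + ∑ k ∈ T, coeff u k • (eta k - g k) := by
        simp only [smul_sub, Finset.sum_sub_distrib, ← hwN]
        rw [show ∑ k ∈ T, coeff u k • eta k = uN from rfl]
        abel
      conv_lhs => rw [this]
      simp only [map_add, map_sum, map_smul]
    change ‖Q (u - w)‖ ≤ _
    rw [hsplit]
    have hsum : ‖∑ k ∈ T, coeff u k • Q (eta k - g k)‖ ≤
        C * √G * (4 / ω) * A * Real.exp (-(μ * (N : ℝ) ^ t)) := by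
      have h2 : Real.exp (-(ω / 4 * (N : ℝ) ^ t)) ≤ Real.exp (-(μ * (N : ℝ) ^ t)) := by
        have := min_le_right η (ω / 4)
        gcongr
      calc ‖∑ k ∈ T, coeff u k • Q (eta k - g k)‖
          ≤ ∑ k ∈ T, A * (C * √G * Real.exp (-(ω / 2) * N)) := by
            refine norm_sum_le_of_le _ fun k hk => ?_
            rw [norm_smul]
            exact mul_le_mul ((abs_coeff_le u k).trans hA) (hmain k hk) (norm_nonneg _) hA0.le
        _ = C * √G * A * (N * Real.exp (-(ω / 2) * N)) := by
            rw [Finset.sum_const, hT, nsmul_eq_mul]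
            ring
        _ ≤ C * √G * A * (4 / ω * Real.exp (-(μ * (N : ℝ) ^ t))) := by
            refine mul_le_mul_of_nonneg_left ((natCast_mul_exp_le hω ht1 N).trans ?_)
              (by positivity)
            gcongr
        _ = _ := by ring
    refine (norm_add_le _ _).trans ((add_le_add ((norm_sub_proj_le _ _).trans hrest)
      hsum).trans (le_of_eq ?_))
    ring

/-- A budget of `M` terms allows `N = ⌊√M / 2⌋`, since `4 N² ≤ M`; this is where the exponent is
halved. Subadditivity of `x ^ t` turns the rounding loss into an additive `1`. -/
theorem sqrt_div_two_rpow_le {t : ℝ} (ht : 0 < t) (ht1 : t ≤ 1) (M : ℕ) :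
    1 / 2 * (M : ℝ) ^ (t / 2) ≤ (⌊√(M : ℝ) / 2⌋₊ : ℝ) ^ t + 1 := by
  have h0 : 0 ≤ √(M : ℝ) := Real.sqrt_nonneg _
  calc 1 / 2 * (M : ℝ) ^ (t / 2) = (1 / 2) ^ (1 : ℝ) * √(M : ℝ) ^ t := by
        rw [Real.sqrt_eq_rpow, ← Real.rpow_mul (Nat.cast_nonneg M), Real.rpow_one]
        ring_nf
    _ ≤ (1 / 2) ^ t * √(M : ℝ) ^ t := by
        refine mul_le_mul_of_nonneg_right ?_ (by positivity)
        exact Real.rpow_le_rpow_of_exponent_ge (by norm_num) (by norm_num) ht1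
    _ = (√(M : ℝ) / 2) ^ t := by
        rw [← Real.mul_rpow (by norm_num) h0]
        ring_nf
    _ ≤ ((⌊√(M : ℝ) / 2⌋₊ : ℝ) + 1) ^ t :=
        Real.rpow_le_rpow (by positivity) (Nat.lt_floor_add_one _).le ht.le
    _ ≤ _ := by
        refine (Real.rpow_add_le_add_rpow (Nat.cast_nonneg _) zero_le_one ht.le ht1).trans ?_
        rw [Real.one_rpow]

/-- Residuals of Galerkin solutions belong to a sparsity class, uniformly in the active set. -/
theorem exists_bestErrDual_residual_le (P : EllipticData) {γ : ℝ} (hγ : 0 < γ)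
    (hexp : ExpClass P.stiffness γ) {η t : ℝ} (hη : 0 < η) (ht : 0 < t) (ht1 : t ≤ 1) :
    ∃ μ : ℝ, 0 < μ ∧ μ ≤ η ∧ ∃ K : ℝ, 0 < K ∧ ∀ (f : Hm1) (u : H10), P.IsSolution f u →
      InClass (bestErr u) η t → ∀ (Λ : Finset N2) (w : H10), P.IsGalerkin f Λ w →
      ∀ N : ℕ, bestErrDual (P.residual f w) N ≤
        K * classNorm (bestErr u) η t * Real.exp (-(μ * (N : ℝ) ^ (t / 2))) := by
  obtain ⟨μ, hμ, hμη, K, hK, h⟩ := exists_residual_approx P hγ hexp hη ht ht1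
  -- The factor `1/2` and the additive `1` of `sqrt_div_two_rpow_le` become the rate `μ / 2` and the
  -- constant `exp μ`.
  refine ⟨μ / 2, by positivity, by linarith, K * Real.exp μ, by positivity, ?_⟩
  intro f u hu hcl Λ w hw M
  have hA := (norm_nonneg u).trans (norm_le_classNorm ht hcl)
  set N := ⌊√(M : ℝ) / 2⌋₊ with hN
  obtain ⟨S, hS, hle⟩ := h f u hu hcl Λ w hw N
  have hcard : S.card ≤ M := by
    refine hS.trans ?_
    have h1 : (N : ℝ) ≤ √(M : ℝ) / 2 := Nat.floor_le (by positivity)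
    have h2 : (4 * (N : ℝ) ^ 2) ≤ M := by
      have := pow_le_pow_left₀ (Nat.cast_nonneg N) h1 2
      rw [div_pow, Real.sq_sqrt (Nat.cast_nonneg M)] at this
      linarith
    exact_mod_cast h2
  rw [bestErrDual_eq]
  refine (bestErr_le hcard _).trans (hle.trans ?_)
  have h3 := sqrt_div_two_rpow_le ht ht1 M
  rw [← hN] at h3
  have h4 : Real.exp (-(μ * (N : ℝ) ^ t)) ≤
      Real.exp μ * Real.exp (-(μ / 2 * (M : ℝ) ^ (t / 2))) := by
    rw [← Real.exp_add]
    refine Real.exp_le_exp.2 ?_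
    have := mul_le_mul_of_nonneg_left h3 hμ.le
    linarith
  calc K * classNorm (bestErr u) η t * Real.exp (-(μ * (N : ℝ) ^ t))
      ≤ K * classNorm (bestErr u) η t *
        (Real.exp μ * Real.exp (-(μ / 2 * (M : ℝ) ^ (t / 2)))) := by gcongr
    _ = _ := by ring

/-! ### Cardinality of the predictor sets -/

/-- By Pythagoras, a tail of at most `√(1 - θ²)` of the residual means a captured part of at least
`θ`, so `Λ` competes in the minimization. -/
theorem IsDorfler.card_le {r : Hm1} {θ : ℝ} {S Λ : Finset N2} (hθ : 0 ≤ θ) (hθ1 : θ ≤ 1)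
    (h : IsDorfler r θ S) (hΛ : ‖riesz r - proj Λ (riesz r)‖ ≤ √(1 - θ ^ 2) * ‖r‖) :
    S.card ≤ Λ.card := by
  refine h.2 Λ ?_
  rw [norm_projDual]
  rw [← norm_riesz] at hΛ ⊢
  refine (sq_le_sq₀ (by positivity) (norm_nonneg _)).1 ?_
  have h1 := norm_sub_proj_sq Λ (riesz r)
  have h2 := pow_le_pow_left₀ (norm_nonneg _) hΛ 2
  rw [mul_pow, Real.sq_sqrt (by nlinarith)] at h2
  rw [mul_pow]
  linarith

/-- Moves a factor `4` inside the power, where it divides the rate by `4`; used with `p = 2 / t`. -/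
theorem four_mul_rpow_le {x p : ℝ} (hx : 0 ≤ x) (hp : 1 ≤ p) : 4 * x ^ p ≤ (4 * x) ^ p := by
  rw [Real.mul_rpow (by norm_num) hx]
  exact mul_le_mul_of_nonneg_right (Real.self_le_rpow_of_one_le (by norm_num) hp)
    (Real.rpow_nonneg hx p)

/-- The residual before the step is sparse, and its size is bounded below by the error after the
step (`IsRun.step`). Hence the accuracy demanded of the marked set is comparable to that new error.
-/
theorem exists_card_predictor_le (P : EllipticData) {B : Matrix N2 N2 ℝ} {Cinv γ γ' : ℝ}
    (hγ : 0 < γ) (hB : IsInverse P.stiffness B)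
    (htrunc : ∀ J : ℕ, OpNormLe (B - trunc J B) (Cinv * Real.exp (-γ * (J : ℝ))))
    (hγ' : 0 < γ') (hexp : ExpClass P.stiffness γ')
    {η t : ℝ} (hη : 0 < η) (ht : 0 < t) (ht1 : t ≤ 1) :
    ∃ ηbar tbar : ℝ, 0 < ηbar ∧ ηbar ≤ η ∧ 0 < tbar ∧ tbar ≤ t ∧
      (∃ K : ℝ, ∀ (f : Hm1) (u : H10), P.IsSolution f u → InClass (bestErr u) η t →
        ∀ (S : Finset N2) (w : H10), P.IsGalerkin f S w →
          InClass (bestErrDual (P.residual f w)) ηbar tbar ∧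
          classNorm (bestErrDual (P.residual f w)) ηbar tbar ≤ K * classNorm (bestErr u) η t) ∧
      ∃ C : ℝ, 1 < C ∧ ∀ (θ tol : ℝ), 0 < θ → θ < 1 →
        ∀ (f : Hm1) (u : H10), P.IsSolution f u → InClass (bestErr u) η t →
        ∀ (M : ℕ) (Lam LamHat : ℕ → Finset N2) (un uHat : ℕ → H10),
          IsRun P f θ tol (enrichRadius P Cinv γ θ) M Lam LamHat un uHat →
          ∀ n < M, un (n + 1) ≠ u →
            0 ≤ Real.log (classNorm (bestErr u) η t / ‖u - un (n + 1)‖) + Real.log C ∧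
            ((LamHat (n + 1)).card : ℝ) ≤ ((Lam n).card : ℝ) +
              2 * (enrichRadius P Cinv γ θ : ℝ) / ηbar ^ (1 / tbar) *
                (Real.log (classNorm (bestErr u) η t / ‖u - un (n + 1)‖) + Real.log C) ^
                  (1 / tbar) +
              2 * (enrichRadius P Cinv γ θ : ℝ) := by
  obtain ⟨μ, hμ, hμη, K, hK, hres⟩ := exists_bestErrDual_residual_le P hγ' hexp hη ht ht1
  have hq := P.quasiOpt_pos
  have hα := P.alphaLo_pos
  have ht2 : 0 < t / 2 := half_pos ht
  refine ⟨μ / 4, t / 2, by positivity, by linarith, ht2, by linarith, ⟨K, ?_⟩, ?_⟩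
  · intro f u hu hcl S w hw
    have hA := (norm_nonneg u).trans (norm_le_classNorm ht hcl)
    refine inClass_of_forall_le fun N => (hres f u hu hcl S w hw N).trans ?_
    have : μ / 4 ≤ μ := by linarith
    gcongr
  -- The first summand lets `σ` be reached at level `X`; the second forces `X ≥ μ / 4`, hence `Z ≥
  -- 1` below; the `2` ensures `C > 1`.
  set C := 16 * P.quasiOpt * K / P.alphaLo + P.quasiOpt * Real.exp (μ / 4) + 2 with hC
  have hC1 : 0 < 16 * P.quasiOpt * K / P.alphaLo := by positivity
  have hC2 : 0 < P.quasiOpt * Real.exp (μ / 4) := by positivity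
  have hC0 : 0 < C := by positivity
  refine ⟨C, by linarith, ?_⟩
  intro θ tol hθ hθ1 f u hu hcl M Lam LamHat un uHat hrun n hn hne
  obtain ⟨hstep, -⟩ := hrun.step hB hγ htrunc hθ hθ1 hu hn
  have hd : 0 < ‖u - un (n + 1)‖ := norm_pos_iff.2 (sub_ne_zero.2 hne.symm)
  have hcea := (hrun.isGalerkin hn).norm_sub_le_norm hu
  have hA := norm_le_classNorm ht hcl
  set A := classNorm (bestErr u) η t with hAdef
  set d := ‖u - un (n + 1)‖ with hddef
  have hdA : d ≤ P.quasiOpt * A := hcea.trans (mul_le_mul_of_nonneg_left hA hq.le)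
  have hA0 : 0 < A := by
    by_contra! h0
    have := mul_nonpos_of_nonneg_of_nonpos hq.le h0
    linarith
  set X := Real.log (A / d) + Real.log C with hX
  have hexpX : Real.exp X = C * A / d := exp_log_div_add_log hA0 hd hC0
  have hXμ : μ / 4 ≤ X := by
    rw [← Real.exp_le_exp, hexpX, le_div_iff₀ hd]
    calc Real.exp (μ / 4) * d ≤ Real.exp (μ / 4) * (P.quasiOpt * A) := by gcongr
      _ = P.quasiOpt * Real.exp (μ / 4) * A := by ring
      _ ≤ C * A := mul_le_mul_of_nonneg_right (by linarith) hA0.le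
  have hX0 : 0 ≤ X := (by positivity : (0 : ℝ) ≤ μ / 4).trans hXμ
  refine ⟨hX0, ?_⟩
  set J := enrichRadius P Cinv γ θ with hJdef
  have hJ : 0 < J := (enrichRadius_spec P Cinv hγ hθ hθ1).1
  set r := P.residual f (un n) with hr
  set σ := √(1 - θ ^ 2) * ‖r‖ with hσ
  have hdσ : d ≤ 8 * P.quasiOpt * (σ / P.alphaLo) := hstep
  have hσ0 : 0 < σ := by
    by_contra! h0
    have h1 := div_nonpos_of_nonpos_of_nonneg h0 hα.le
    have := mul_nonpos_of_nonneg_of_nonpos (by positivity : 0 ≤ 8 * P.quasiOpt) h1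
    linarith
  obtain ⟨S, hS, hhat⟩ := hrun.predictor_set n hn
  have hresn := hres f u hu hcl (Lam n) (un n) (hrun.isGalerkin hn.le)
  rw [bestErrDual_eq] at hresn
  obtain ⟨hclr, hclr'⟩ := inClass_of_forall_le hresn
  obtain ⟨Λ, hΛ, hΛcard⟩ := exists_card_le_of_inClass hμ ht2 hclr hσ0 hX0 (by
    rw [hexpX, mul_div_assoc', le_div_iff₀ hd]
    have h1 : 16 * P.quasiOpt * K / P.alphaLo ≤ C := by linarith
    calc 2 * classNorm (bestErr (riesz r)) μ (t / 2) * d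
        ≤ 2 * (K * A) * (8 * P.quasiOpt * (σ / P.alphaLo)) := by gcongr
      _ = σ * (16 * P.quasiOpt * K / P.alphaLo * A) := by ring
      _ ≤ σ * (C * A) := by gcongr)
  have hSΛ := hS.card_le hθ.le hθ1.le hΛ
  set Z := 1 / (μ / 4) ^ (1 / (t / 2)) * X ^ (1 / (t / 2)) with hZ
  have hp : 1 ≤ 1 / (t / 2) := by
    rw [one_le_div ht2]
    linarith
  have hZ' : Z = (4 * (X / μ)) ^ (1 / (t / 2)) := by
    rw [hZ, one_div_mul_eq_div, ← Real.div_rpow hX0 (by positivity)]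
    congr 1
    field_simp
  have hZ1 : 1 ≤ Z := by
    rw [hZ']
    refine Real.one_le_rpow ?_ (by positivity)
    rw [mul_div_assoc', le_div_iff₀ hμ]
    linarith
  have hZ4 : 4 * (1 / μ ^ (1 / (t / 2)) * X ^ (1 / (t / 2))) ≤ Z := by
    rw [hZ', one_div_mul_eq_div, ← Real.div_rpow hX0 hμ.le]
    exact four_mul_rpow_le (by positivity) hp
  have hScard : (S.card : ℝ) ≤ Z / 4 + 1 := by
    have : (S.card : ℝ) ≤ Λ.card := by exact_mod_cast hSΛ
    linarith
  have hcard : ((LamHat (n + 1)).card : ℝ) ≤ (Lam n).card + S.card * (2 * J + 1) := by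
    rw [hhat]
    exact_mod_cast (Finset.card_union_le _ _).trans
      (Nat.add_le_add_left (card_enrich_le S J) _)
  -- With `J ≥ 1`, `2 J + 1 ≤ 3 J`; the excess `J` in `(Z / 4 + 1) (3 J)` over the additive term `2
  -- J` is absorbed using `Z ≥ 1`.
  have hJ1 : (1 : ℝ) ≤ J := by exact_mod_cast hJ
  have hfin : (S.card : ℝ) * (2 * J + 1) ≤ 2 * J * Z + 2 * J := by
    calc (S.card : ℝ) * (2 * J + 1) ≤ (Z / 4 + 1) * (3 * J) :=
          mul_le_mul hScard (by linarith) (by positivity) (by positivity)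
      _ ≤ 2 * J * Z + 2 * J := by nlinarith
  have heq : 2 * (J : ℝ) / (μ / 4) ^ (1 / (t / 2)) * X ^ (1 / (t / 2)) = 2 * J * Z := by
    rw [hZ]
    ring
  rw [heq]
  linarith

end PCADLEG

end

/-! ### Assembly of the three statements -/

theorem mainTheorem2 (P : EllipticData) (B : Matrix N2 N2 ℝ) (Cinv etaBarL : ℝ)
    (hetaBarL : 0 < etaBarL) (hB : IsInverse P.stiffness B)
    (htrunc : ∀ J : ℕ, OpNormLe (B - trunc J B) (Cinv * Real.exp (-etaBarL * (J : ℝ))))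
    (η t : ℝ) (hη : 0 < η) (ht : 0 < t) (ht1 : t ≤ 1) :
    -- cardinality of the active sets
    (∃ C : ℝ, 1 < C ∧ ∀ (θ tol : ℝ), 0 < θ → θ < 1 → 0 ≤ tol → tol < 1 →
      ∀ (f : Hm1) (u : H10), P.IsSolution f u → InClass (bestErr u) η t →
      ∀ (M : ℕ) (Lam LamHat : ℕ → Finset N2) (un uHat : ℕ → H10),
        IsRun P f θ tol (enrichRadius P Cinv etaBarL θ) M Lam LamHat un uHat →
        ∀ n ≤ M, un n ≠ u →
          0 ≤ Real.log (classNorm (bestErr u) η t / ‖u - un n‖) + Real.log C ∧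
          ((Lam n).card : ℝ) ≤ 1 / η ^ (1 / t) *
            (Real.log (classNorm (bestErr u) η t / ‖u - un n‖) + Real.log C) ^ (1 / t) + 1) ∧
    -- optimality of this bound relative to the class
    (∀ K ε : ℝ, 0 < ε → ε < K → ∃ v : H10, InClass (bestErr v) η t ∧
      classNorm (bestErr v) η t = K ∧
      ∀ S : Finset N2, ‖v - proj S v‖ ≤ ε →
        1 / η ^ (1 / t) * (Real.log (K / ε)) ^ (1 / t) ≤ (S.card : ℝ)) ∧
    -- cardinality of the predictor sets
    (∀ etaL : ℝ, ExpClass P.stiffness etaL → ExpClass B etaBarL → etaBarL ≤ etaL → η < etaBarL →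
      ∃ ηbar tbar : ℝ, 0 < ηbar ∧ ηbar ≤ η ∧ 0 < tbar ∧ tbar ≤ t ∧
        (∃ K : ℝ, ∀ (f : Hm1) (u : H10), P.IsSolution f u → InClass (bestErr u) η t →
          ∀ (S : Finset N2) (w : H10), P.IsGalerkin f S w →
            InClass (bestErrDual (P.residual f w)) ηbar tbar ∧
            classNorm (bestErrDual (P.residual f w)) ηbar tbar ≤ K * classNorm (bestErr u) η t) ∧
        ∃ C : ℝ, 1 < C ∧ ∀ (θ tol : ℝ), 0 < θ → θ < 1 → 0 ≤ tol → tol < 1 →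
          ∀ (f : Hm1) (u : H10), P.IsSolution f u → InClass (bestErr u) η t →
          ∀ (M : ℕ) (Lam LamHat : ℕ → Finset N2) (un uHat : ℕ → H10),
            IsRun P f θ tol (enrichRadius P Cinv etaBarL θ) M Lam LamHat un uHat →
            ∀ n < M, un (n + 1) ≠ u →
              0 ≤ Real.log (classNorm (bestErr u) η t / ‖u - un (n + 1)‖) + Real.log C ∧
              ((LamHat (n + 1)).card : ℝ) ≤ ((Lam n).card : ℝ) +
                2 * (enrichRadius P Cinv etaBarL θ : ℝ) / ηbar ^ (1 / tbar) *
                  (Real.log (classNorm (bestErr u) η t / ‖u - un (n + 1)‖) + Real.log C) ^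
                    (1 / tbar) +
                2 * (enrichRadius P Cinv etaBarL θ : ℝ)) := by
  refine ⟨?_, fun K ε hε hK => exists_card_ge_of_norm_sub_proj_le hη ht ht1 hε hK, ?_⟩
  · obtain ⟨C, hC, h⟩ := exists_card_active_le P hetaBarL hB htrunc hη ht
    exact ⟨C, hC, fun θ tol hθ hθ1 _ _ => h θ tol hθ hθ1⟩
  · intro etaL hexp _ hle _
    -- The decay rate of the stiffness matrix is positive because it dominates `etaBarL`.
    obtain ⟨ηbar, tbar, h1, h2, h3, h4, h5, C, hC, h⟩ :=
      exists_card_predictor_le P hetaBarL hB htrunc (hetaBarL.trans_le hle) hexp hη ht ht1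
    exact ⟨ηbar, tbar, h1, h2, h3, h4, h5, C, hC, fun θ tol hθ hθ1 _ _ => h θ tol hθ hθ1⟩
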